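/- **Setting.** Let $t_a,t_b$ be coprime positive integers, $n\ge 1$, $A=nt_a$, $B=nt_b$, $m=A+B$. A *configuration* is a sequence $c=(c_0,\dots,c_m)$ in $\mathbb N^2$ with $c_0=(0,0)$, $c_m=(A,B)$ and each step $c_i-c_{i-1}$ equal to $a=(1,0)$ or $b=(0,1)$; its word is $w_1\cdots w_m$, $w_i=c_i-c_{i-1}$. The height of $(x,y)$ is $h(x,y)=-t_bx+t_ay$; $h_{\min}(c),h_{\max}(c)$ are the minimum and maximum of $h(c_i)$, $0\le i\le m$. The configuration $c$ is *nonnegative* if all $h(c_i)\ge 0$, and *Christoffel* if $h_{\max}(c)-h_{\min}(c)=t_a+t_b-1$. *Flipping* in $c_i$ ($1\le i\le m-1$) exchanges the letters $w_i$ and $w_{i+1}$. Fix a sight $s\ge 1$. The right word at $i$ is $w_{i+1}w_{i+2}\cdots w_{\min(i+s,m)}$, the left word at $i$ is $w_iw_{i-1}\cdots w_{\max(i-s+1,1)}$. A local rule is a map $\delta$ from pairs of nonempty words over $\{a,b\}$ of length at most $s$ to $\{0,1\}$; it is *totally symmetric* if $\delta(w,w')=\delta(w',w)=\delta(g(w),g(w'))$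 for all $w,w'$, where $g$ exchanges $a$ and $b$. The site $c_i$, $1\le i\le m-1$, is *active* if $\delta(\text{left word},\text{right word})=1$; $c$ is *stable* if no site is active. The random process of $\delta$ starts at a configuration $c^0$; at each time step an index $i\in\{1,\dots,m-1\}$ is chosen uniformly at random, independently of the past, and $c_i$ is flipped if it is active (otherwise nothing is done). **The rule.** $\delta(w,w')=\max\{\delta^r(w,w'),\delta^r(w',w)\}$, where $\delta^r$ is defined as follows. If $w_1=w'_1$ then $\delta^r(w,w')=0$. If $w'_1=a$ and $w_1=b$ then $\delta^r(w,w')=\delta^r(g(w),g(w'))$. If $w_1=a$ and $w'_1=b$, let $a_j,b_j$ (resp. $a'_i,b'_i$) be the numbers of $a$ and $b$ in the prefix of $w$ of length $j$ (resp. of $w'$ of length $i$), and let $(r_a,r_b)=(a'_i,b'_i)$ for the least $i\in\{1,\dots,|w'|\}$ minimizing $b'_i/a'_i$ (with $b/0=+\infty$). Then $\delta^r(w,w')=1$ if and only if 1. $|w'|=s$; 2. there is $1\le j\le |w|$ with $r_ba_j-r_ab_j\ge r_a+r_b$; 3. there is $1\le j\le|w|$ with $r_ba_j-r_ab_j>r_a+r_b$,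 or with $r_ba_j-r_ab_j=r_a+r_b$ and $\gcd(a_j-1,b_j+1)=1$. **Theorem.** For all coprime positive integers $t_a,t_b$ there is a constant $C$, depending only on $(t_a,t_b)$, such that for every $s\ge t_a+t_b$ and every $n\ge1$: * the rule $\delta$ is totally symmetric, and all Christoffel configurations are stable; * there is exactly one configuration $c^*$ with $h_{\min}(c^*)=0$ and $h_{\max}(c^*)=t_a+t_b-1$ (it is Christoffel, hence stable); * if moreover $2s\le A+B+1$ (that is, every site $c_1,\dots,c_{m-1}$ has at least $s$ letters on one of its two sides), then for every nonnegative initial configuration $c^0$ the process almost surely reaches a Christoffel configuration, from the first such time $T$ on it is equal to $c^*$, and $\mathbb E[T]\le C\,n^4$. -/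

import Mathlib

open MeasureTheory ProbabilityTheory
open scoped ENNReal NNReal

namespace FlipProcess

/-! ### Letters, configurations, heights -/

/-- The two letters: `a` is a horizontal unit step, `b` is a vertical unit step. -/
inductive Letter where
  | a : Letter
  | b : Letter
  deriving DecidableEq

namespace Letter

/-- The exchange `g` of the two letters. -/
def swap : Letter → Letter
  | a => b
  | b => a

/-- The unit vector of a letter. -/
def vec : Letter → ℕ × ℕ
  | a => (1, 0)
  | b => (0, 1)

end Letter

/-- A configuration: a chain of sites `c_0, …, c_{A+B}` from `(0,0)` to `(A,B)` whose steps are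
`(1,0)` or `(0,1)`. The sequence is indexed by all of `ℕ`; it is constant from the index `A+B` on, so
that two configurations are equal exactly when their sites `c_0, …, c_{A+B}` are. -/
@[ext]
structure Config (A B : ℕ) where
  site : ℕ → ℕ × ℕ
  site_zero : site 0 = (0, 0)
  site_of_ge : ∀ i, A + B ≤ i → site i = (A, B)
  step : ∀ i, i < A + B → ∃ l : Letter, site (i + 1) = site i + l.vec

/-- The height of the site `(x, y)` relative to the slope `tb / ta`. -/
def height (ta tb : ℕ) (p : ℕ × ℕ) : ℤ := -(tb : ℤ) * (p.1 : ℤ) + (ta : ℤ) * (p.2 : ℤ)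

namespace Config

variable {A B : ℕ}

/-- The minimal height of the sites of a configuration. -/
def hMin (ta tb : ℕ) (c : Config A B) : ℤ :=
  (Finset.range (A + B + 1)).inf' ⟨0, by simp⟩ (fun i => height ta tb (c.site i))

/-- The maximal height of the sites of a configuration. -/
def hMax (ta tb : ℕ) (c : Config A B) : ℤ :=
  (Finset.range (A + B + 1)).sup' ⟨0, by simp⟩ (fun i => height ta tb (c.site i))

/-- Christoffel configurations of slope `tb / ta`: the thickness is `ta + tb - 1`. -/
def IsChristoffel (ta tb : ℕ) (c : Config A B) : Prop :=
  c.hMax ta tb - c.hMin ta tb = (ta : ℤ) + (tb : ℤ) - 1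

/-- All sites have nonnegative height. -/
def IsNonneg (ta tb : ℕ) (c : Config A B) : Prop :=
  ∀ i, i ≤ A + B → 0 ≤ height ta tb (c.site i)

/-- The letter `w_i` of the word of `c`, for `1 ≤ i ≤ A + B`: the letter of the step from `c_{i-1}`
to `c_i`. -/
def letter (c : Config A B) (i : ℕ) : Letter :=
  if c.site i = c.site (i - 1) + Letter.vec Letter.a then Letter.a else Letter.b

/-- The right word at `i` for the sight `s`: `w_{i+1} w_{i+2} … w_{min (i+s) (A+B)}`. -/
def rightWord (s : ℕ) (c : Config A B) (i : ℕ) : List Letter :=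
  (List.range (min s (A + B - i))).map (fun k => c.letter (i + 1 + k))

/-- The left word at `i` for the sight `s`, read from `c_i`: `w_i w_{i-1} … w_{max (i-s+1) 1}`. -/
def leftWord (s : ℕ) (c : Config A B) (i : ℕ) : List Letter :=
  (List.range (min s i)).map (fun k => c.letter (i - k))

theorem site_succ (c : Config A B) (i : ℕ) (hi : i < A + B) :
    c.site (i + 1) = c.site i + (c.letter (i + 1)).vec := by
  obtain ⟨l, hl⟩ := c.step i hi
  cases l with
  | a => simp [letter, hl]
  | b => simp [letter, hl, Letter.vec]

/-- Flipping in the site `c_i`, `1 ≤ i ≤ A + B - 1`: the letters `w_i` and `w_{i+1}` are exchanged, so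
that `c_i` is replaced by `c_{i-1} + w_{i+1}` and no other site moves. (Nothing is done for other
values of `i`.) -/
def flip (c : Config A B) (i : ℕ) : Config A B :=
  if h : 1 ≤ i ∧ i < A + B then
    { site := Function.update c.site i (c.site (i - 1) + (c.letter (i + 1)).vec)
      site_zero := by
        rw [Function.update_of_ne (by omega)]
        exact c.site_zero
      site_of_ge := by
        intro j hj
        rw [Function.update_of_ne (by omega)]
        exact c.site_of_ge j hj
      step := by
        intro j hj
        obtain ⟨h1, h2⟩ := h
        by_cases hji : j = i
        · subst hji
          refine ⟨c.letter j, ?_⟩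
          rw [Function.update_of_ne (by omega), Function.update_self, c.site_succ j hj]
          have h3 := c.site_succ (j - 1) (by omega)
          rw [Nat.sub_add_cancel h1] at h3
          rw [h3]
          abel
        · by_cases hji' : j + 1 = i
          · subst hji'
            refine ⟨c.letter (j + 1 + 1), ?_⟩
            rw [Function.update_self, Function.update_of_ne (by omega), Nat.add_sub_cancel]
          · rw [Function.update_of_ne hji', Function.update_of_ne hji]
            exact c.step j hj }
  else c

end Config

/-! ### Local transition rules and the random process -/

/-- A local transition rule, as the set of pairs (left word, right word) on which it is `1`. For the
sight `s` only nonempty words of length at most `s` matter. -/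
abbrev LocalRule := List Letter → List Letter → Prop

/-- The nonempty words of length at most `s`. -/
def IsWord (s : ℕ) (w : List Letter) : Prop := 1 ≤ w.length ∧ w.length ≤ s

/-- The rule is invariant by exchange of its two arguments and by exchange of the two letters. -/
def TotallySymmetric (s : ℕ) (δ : LocalRule) : Prop :=
  ∀ w w', IsWord s w → IsWord s w' →
    (δ w w' ↔ δ w' w) ∧ (δ w w' ↔ δ (w.map Letter.swap) (w'.map Letter.swap))

namespace Config

variable {A B : ℕ}

/-- The site `c_i` is active. -/
def Active (s : ℕ) (δ : LocalRule) (c : Config A B) (i : ℕ) : Prop :=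
  δ (c.leftWord s i) (c.rightWord s i)

/-- A configuration is stable when none of its sites `c_1, …, c_{A+B-1}` is active. -/
def IsStable (s : ℕ) (δ : LocalRule) (c : Config A B) : Prop :=
  ∀ i, 1 ≤ i → i ≤ A + B - 1 → ¬ c.Active s δ i

open Classical in
/-- One step of the process when the index `i` has been selected: the site `c_i` is flipped if it is
active, otherwise nothing is done. -/
noncomputable def update (s : ℕ) (δ : LocalRule) (c : Config A B) (i : ℕ) : Config A B :=
  if c.Active s δ i then c.flip i else c

/-- The configuration at time `t`, from the initial configuration `c`, when the index `I t` is selected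
at time `t`. -/
noncomputable def trajectory (s : ℕ) (δ : LocalRule) (c : Config A B) (I : ℕ → ℕ) : ℕ → Config A B
  | 0 => c
  | t + 1 => (trajectory s δ c I t).update s δ (I t)

/-- The first time at which the trajectory is at a Christoffel configuration (`∞` if there is none). -/
noncomputable def coalescenceTime (ta tb s : ℕ) (δ : LocalRule) (c : Config A B) (I : ℕ → ℕ) : ℝ≥0∞ :=
  ⨅ (t : ℕ) (_ : (c.trajectory s δ I t).IsChristoffel ta tb), (t : ℝ≥0∞)

end Config

/-- The random indices `I 0, I 1, …` are independent and uniform on `{1, …, m - 1}`. -/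
structure IsUniformSelection {Ω : Type*} [MeasurableSpace Ω] (μ : Measure Ω) (m : ℕ)
    (I : ℕ → Ω → ℕ) : Prop where
  measurable : ∀ t, Measurable (I t)
  indep : iIndepFun I μ
  uniform : ∀ t, ∀ i ∈ Finset.Icc 1 (m - 1), μ {ω | I t ω = i} = ((m - 1 : ℕ) : ℝ≥0∞)⁻¹

/-! ### The specific rule -/

/-- Number of letters `a` in the prefix of length `i`. -/
def numA (w : List Letter) (i : ℕ) : ℕ := (w.take i).count Letter.a

/-- Number of letters `b` in the prefix of length `i`. -/
def numB (w : List Letter) (i : ℕ) : ℕ := (w.take i).count Letter.b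

/-- `i` is the lowest among the lengths `1 ≤ i ≤ |w'|` of the prefixes of `w'` for which the slope
`b'_i / a'_i` is minimal (with `b / 0 = +∞`). Slopes are compared by cross-multiplication. -/
def IsLowestSlope (w' : List Letter) (i : ℕ) : Prop :=
  1 ≤ i ∧ i ≤ w'.length ∧
    (∀ k, 1 ≤ k → k ≤ w'.length → numB w' i * numA w' k ≤ numB w' k * numA w' i) ∧
    (∀ k, 1 ≤ k → k < i → numB w' i * numA w' k < numB w' k * numA w' i)

/-- The weak thickness constraint `∃ j, r_b a_j - r_a b_j ≥ r_a + r_b` on the left word `w`. -/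
def WeakThickness (w : List Letter) (ra rb : ℕ) : Prop :=
  ∃ j, 1 ≤ j ∧ j ≤ w.length ∧
    (ra : ℤ) + rb ≤ (rb : ℤ) * numA w j - (ra : ℤ) * numB w j

/-- The strong thickness constraint on the left word `w`: for some `j`, either
`r_b a_j - r_a b_j > r_a + r_b`, or there is equality and `a_j - 1`, `b_j + 1` are coprime. -/
def StrongThickness (w : List Letter) (ra rb : ℕ) : Prop :=
  ∃ j, 1 ≤ j ∧ j ≤ w.length ∧
    ((ra : ℤ) + rb < (rb : ℤ) * numA w j - (ra : ℤ) * numB w j ∨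
      ((rb : ℤ) * numA w j - (ra : ℤ) * numB w j = (ra : ℤ) + rb ∧
        Int.gcd ((numA w j : ℤ) - 1) ((numB w j : ℤ) + 1) = 1))

/-- The rule `δ^r` in the case where the right word `w'` begins with `b` and the left word `w` begins
with `a`: the sight constraint and the two thickness constraints. -/
def rightRuleB (s : ℕ) : LocalRule := fun w w' =>
  w.head? = some Letter.a ∧ w'.head? = some Letter.b ∧ w'.length = s ∧
    ∃ i, IsLowestSlope w' i ∧
      WeakThickness w (numA w' i) (numB w' i) ∧ StrongThickness w (numA w' i) (numB w' i)

/-- The rule `δ^r`: it is `0` when the two words begin with the same letter, and invariant by exchange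
of the letters. -/
def rightRule (s : ℕ) : LocalRule := fun w w' =>
  rightRuleB s w w' ∨ rightRuleB s (w.map Letter.swap) (w'.map Letter.swap)

/-- The rule `δ = max {δ^r, δ^l}`, where `δ^l (w, w') = δ^r (w', w)`. -/
def rule (s : ℕ) : LocalRule := fun w w' => rightRule s w w' ∨ rightRule s w' w

end FlipProcess

namespace FlipProcess

/-! Put `p = ta + tb`, let `M` be the maximal height and `S` the set of sites of height `M`. Heights
at indices differing by `p` differ by a multiple of `p`, and a flip moves one height by `p`. The
rule measures slopes only locally, but at the true slope it moves a site only towards some site at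
least `p` away in height (`Config.update_cases`). Hence the range of heights never grows, and a
thickness of `p - 1` freezes the configuration.

While `M ≥ p`, cut `S` into runs of step `p`. The quantity `spread`, which is the size of `S` plus
the number of its runs, changes at a flip by the number of vacant neighbours at distance `p`, so
only the ends of runs matter. A site raised to `M` always touches a run
(`LevelData.raised_adjacent`), so each possible growth at an end is balanced by the lowering of that
end if it is active. An inactive end exists only for `M = p` and near an extremity of the chain;
then the opposite end of its run is active and does not grow (`LevelData.inactive_end`). So `spread`
does not increase in mean (`sum_vacancies_le`), and at least one move really changes it
(`exists_active_end`).

A concave increasing function of `spread`, added to a large multiple of `M - p`, therefore loses at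
least `1 / (m - 1)` in mean per step (`Config.sum_potential_update_lt`). This potential is of order
`n ^ 3`, whence a mean time of order `n ^ 4` (`Config.tsum_measure_bad_le`). Nonnegativity is
preserved, and it serves to identify the configuration once `M < p`: each height is then the
remainder of `ta * i` modulo `p`. -/

/-! ### Prefix counts, and the rule compared with a fixed slope -/

theorem count_a_add_count_b (w : List Letter) :
    w.count Letter.a + w.count Letter.b = w.length := by
  induction w with
  | nil => rfl
  | cons l w ih => cases l <;> simp <;> omega

theorem numA_add_numB (w : List Letter) {i : ℕ} (hi : i ≤ w.length) :
    numA w i + numB w i = i := by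
  rw [numA, numB, count_a_add_count_b, List.length_take, min_eq_left hi]

theorem Letter.swap_swap (l : Letter) : l.swap.swap = l := by cases l <;> rfl

theorem map_swap_map_swap (w : List Letter) : (w.map Letter.swap).map Letter.swap = w := by
  simp [Function.comp_def, Letter.swap_swap]

theorem numA_map_swap (w : List Letter) (i : ℕ) : numA (w.map Letter.swap) i = numB w i := by
  have (v : List Letter) : (v.map Letter.swap).count Letter.a = v.count Letter.b := by
    induction v with
    | nil => rfl
    | cons l v ih => cases l <;> simp [Letter.swap, ih]
  rw [numA, numB, ← List.map_take, this]

theorem numB_map_swap (w : List Letter) (i : ℕ) : numB (w.map Letter.swap) i = numA w i := by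
  rw [← numA_map_swap, map_swap_map_swap]

/-- Comparing `b / a`, possibly infinite, amounts to comparing `b / (a + b)`, whose denominator is
the length of the prefix and never vanishes. The same translation makes minimality transitive, which
gives strictness before the least minimizer. -/
theorem exists_isLowestSlope (w : List Letter) (hw : 1 ≤ w.length) : ∃ i, IsLowestSlope w i := by
  classical
  let IsMin : ℕ → Prop := fun i => 1 ≤ i ∧ i ≤ w.length ∧
    ∀ k, 1 ≤ k → k ≤ w.length → numB w i * numA w k ≤ numB w k * numA w i
  have cross : ∀ i k, i ≤ w.length → k ≤ w.length →
      (numB w i * k ≤ numB w k * i ↔ numB w i * numA w k ≤ numB w k * numA w i) := by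
    intro i k hi hk
    have h1 := numA_add_numB w hi
    have h2 := numA_add_numB w hk
    generalize numA w i = a at *
    generalize numA w k = a' at *
    generalize numB w i = b at *
    generalize numB w k = b' at *
    subst h1 h2
    constructor <;> intro h <;> nlinarith
  have hex : ∃ i, IsMin i := by
    obtain ⟨i, hi, hmin⟩ := Finset.exists_min_image (Finset.Icc 1 w.length)
      (fun i => (numB w i : ℚ) / i) ⟨1, by simp [hw]⟩
    rw [Finset.mem_Icc] at hi
    refine ⟨i, hi.1, hi.2, fun k hk hk' => ?_⟩
    rw [← cross i k hi.2 hk']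
    have h := hmin k (Finset.mem_Icc.2 ⟨hk, hk'⟩)
    rw [div_le_div_iff₀ (by exact_mod_cast hi.1) (by exact_mod_cast hk)] at h
    exact_mod_cast h
  obtain ⟨h1, h2, h3⟩ := Nat.find_spec hex
  refine ⟨Nat.find hex, h1, h2, h3, fun k hk hki => ?_⟩
  by_contra! hle
  refine Nat.find_min hex hki ⟨hk, by omega, fun l hl hl' => ?_⟩
  rw [← cross k l (by omega) hl']
  have e1 := (cross k _ (by omega) h2).2 hle
  have e2 := (cross _ l h2 hl').2 (h3 l hl hl')
  have h4 : 0 < Nat.find hex := h1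
  refine Nat.le_of_mul_le_mul_left ?_ h4
  calc _ = (numB w k * Nat.find hex) * l := by ring
    _ ≤ (numB w (Nat.find hex) * k) * l := by gcongr
    _ = (numB w (Nat.find hex) * l) * k := by ring
    _ ≤ (numB w l * Nat.find hex) * k := by gcongr
    _ = _ := by ring

/-- What the rule `δ^r` sees, measured with the heights of slope `v / u`. -/
theorem rightRuleB_cases {s : ℕ} {w w' : List Letter} {u v : ℕ} (hu : 0 < u)
    (huv : Nat.Coprime u v) (h : rightRuleB s w w') :
    (∃ j, 1 ≤ j ∧ j ≤ w.length ∧ (u : ℤ) + v ≤ (v : ℤ) * numA w j - u * numB w j ∧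
      ((v : ℤ) * numA w j - u * numB w j = u + v → j = u + v)) ∨
    ∀ k, 1 ≤ k → k ≤ s → (v : ℤ) * numA w' k < u * numB w' k := by
  obtain ⟨-, -, hs, i, ⟨hi1, hi2, hmin, -⟩, -, j, hj1, hj2, hst⟩ := h
  have hr := numA_add_numB w' hi2
  have hj := numA_add_numB w hj2
  generalize numA w' i = ra at *
  generalize numB w' i = rb at *
  generalize hAj : numA w j = A at *
  generalize hBj : numB w j = B at *
  -- If the minimal slope `rb / ra` is at most `v / u`, thickness at slope `rb / ra` implies
  -- thickness at slope `v / u`. Otherwise every prefix of `w'` is strictly steeper than `v / u`.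
  rcases le_or_gt (u * rb) (v * ra) with hle | hlt
  · left
    have hra : 0 < ra := by
      rcases Nat.eq_zero_or_pos ra with h0 | h0
      · subst h0
        have : 0 < u * rb := Nat.mul_pos hu (by omega)
        omega
      · exact h0
    refine ⟨j, hj1, hj2, ?_⟩
    rw [hAj, hBj]
    have key : (ra : ℤ) * (B + 1) ≤ rb * (A - 1) := by
      rcases hst with h | ⟨h, -⟩ <;> linarith
    have hle' : (u : ℤ) * rb ≤ v * ra := by exact_mod_cast hle
    have hra' : (0 : ℤ) < ra := by exact_mod_cast hra
    have hu' : (0 : ℤ) < u := by exact_mod_cast hu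
    have hA : (0 : ℤ) < A - 1 := by
      have h1 : (0 : ℤ) < rb * (A - 1) := lt_of_lt_of_le (by positivity) key
      exact pos_of_mul_pos_right h1 (by positivity)
    have e1 : (ra : ℤ) * (u * (B + 1)) ≤ ra * (v * (A - 1)) := by
      calc (ra : ℤ) * (u * (B + 1)) = u * (ra * (B + 1)) := by ring
        _ ≤ u * (rb * (A - 1)) := by gcongr
        _ = (u * rb) * (A - 1) := by ring
        _ ≤ (v * ra) * (A - 1) := by gcongr
        _ = _ := by ring
    have e2 := le_of_mul_le_mul_left e1 hra'
    refine ⟨by linarith, fun heq => ?_⟩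
    have e3 : (u : ℤ) * (B + 1) = v * (A - 1) := by linarith
    have e4 : (rb : ℤ) * (A - 1) = ra * (B + 1) := by
      refine le_antisymm ?_ key
      refine le_of_mul_le_mul_left ?_ hu'
      calc (u : ℤ) * (rb * (A - 1)) = (u * rb) * (A - 1) := by ring
        _ ≤ (v * ra) * (A - 1) := by gcongr
        _ = ra * (v * (A - 1)) := by ring
        _ = _ := by rw [← e3]; ring
    rcases hst with h | ⟨-, hg⟩
    · linarith
    -- In the equality case `(A - 1, B + 1)` is parallel to `(u, v)`. Both pairs are coprime, so
    -- they coincide and `j = A + B = u + v`.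
    · obtain ⟨A', rfl⟩ : ∃ A', A = A' + 1 := ⟨A - 1, by omega⟩
      have hg' : Nat.Coprime A' (B + 1) := by
        have : (((A' + 1 : ℕ) : ℤ) - 1) = (A' : ℤ) := by push_cast; ring
        rw [this] at hg
        exact_mod_cast hg
      have e5 : u * (B + 1) = v * A' := by
        have : (u : ℤ) * (B + 1) = v * A' := by rw [e3]; push_cast; ring
        exact_mod_cast this
      have h1 : u ∣ A' := huv.dvd_of_dvd_mul_left ⟨_, e5.symm⟩
      have h2 : A' ∣ u := hg'.dvd_of_dvd_mul_right ⟨v, by rw [e5]; ring⟩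
      have h3 : A' = u := Nat.dvd_antisymm h2 h1
      subst h3
      have h4 : B + 1 = v := Nat.eq_of_mul_eq_mul_left hu (by rw [e5]; ring)
      omega
  · right
    intro k hk hk'
    have h1 := hmin k hk (by omega)
    have h2 := numA_add_numB w' (show k ≤ w'.length by omega)
    generalize numA w' k = A' at *
    generalize numB w' k = B' at *
    suffices v * A' < u * B' by exact_mod_cast this
    rcases Nat.eq_zero_or_pos A' with h0 | h0
    · subst h0
      have : 0 < u * B' := Nat.mul_pos hu (by omega)
      omega
    · have hra : 0 < ra := by
        rcases Nat.eq_zero_or_pos ra with h3 | h3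
        · subst h3
          have : 0 < rb * A' := Nat.mul_pos (by omega) h0
          omega
        · exact h3
      refine lt_of_mul_lt_mul_left (a := ra) ?_ (by omega)
      calc ra * (v * A') = (v * ra) * A' := by ring
        _ < (u * rb) * A' := by gcongr
        _ = u * (rb * A') := by ring
        _ ≤ u * (B' * ra) := by gcongr
        _ = _ := by ring

/-- A sufficient condition for `δ^r`, at a site that is lowest for the slope `v / u`. -/
theorem rightRuleB_of_lowest {s : ℕ} {w w' : List Letter} {u v : ℕ} (hu : 0 < u) (hv : 0 < v)
    (huv : Nat.Coprime u v) (hw : w.head? = some Letter.a) (hw' : w'.head? = some Letter.b)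
    (hs : w'.length = s)
    (hlow : ∀ k, 1 ≤ k → k ≤ s → (v : ℤ) * numA w' k ≤ u * numB w' k)
    {j : ℕ} (hj1 : 1 ≤ j) (hj2 : j ≤ w.length)
    (hj : (u : ℤ) + v < (v : ℤ) * numA w j - u * numB w j ∨
      (u : ℤ) + v ≤ (v : ℤ) * numA w j - u * numB w j ∧ j = u + v) :
    rightRuleB s w w' := by
  have hlen : 1 ≤ w'.length := by
    cases w' with
    | nil => simp at hw'
    | cons => simp
  obtain ⟨i, hi⟩ := exists_isLowestSlope w' hlen
  refine ⟨hw, hw', hs, i, hi, ?_⟩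
  have hr := numA_add_numB w' hi.2.1
  have hjj := numA_add_numB w hj2
  have hl := hlow i hi.1 (hs ▸ hi.2.1)
  have hpos := hi.1
  have hle : (numA w' i : ℤ) + numB w' i ≤ (numB w' i : ℤ) * numA w j - numA w' i * numB w j ∧
      ((numA w' i : ℤ) + numB w' i < (numB w' i : ℤ) * numA w j - numA w' i * numB w j ∨
      ((numB w' i : ℤ) * numA w j - (numA w' i : ℤ) * numB w j = (numA w' i : ℤ) + numB w' i ∧
        Int.gcd ((numA w j : ℤ) - 1) ((numB w j : ℤ) + 1) = 1)) := by
    generalize numA w' i = ra at *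
    generalize numB w' i = rb at *
    generalize numA w j = A at *
    generalize numB w j = B at *
    have hu' : (0 : ℤ) < u := by exact_mod_cast hu
    have hv' : (0 : ℤ) < v := by exact_mod_cast hv
    -- Thickness is a condition on the slope of `(A - 1, B + 1)`. As the site is lowest, the minimal
    -- slope `rb / ra` is at least `v / u`, so the inequality passes from `v / u` to `rb / ra`.
    have hweak : (u : ℤ) * (B + 1) ≤ v * (A - 1) := by
      rcases hj with h | ⟨h, -⟩ <;> linarith
    have hA : (0 : ℤ) < A - 1 := by
      have h1 : (0 : ℤ) < v * (A - 1) := lt_of_lt_of_le (by positivity) hweak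
      exact pos_of_mul_pos_right h1 (by positivity)
    have e1 : (ra : ℤ) * (B + 1) ≤ rb * (A - 1) := by
      refine le_of_mul_le_mul_left ?_ hu'
      calc (u : ℤ) * (ra * (B + 1)) = ra * (u * (B + 1)) := by ring
        _ ≤ ra * (v * (A - 1)) := by gcongr
        _ = (v * ra) * (A - 1) := by ring
        _ ≤ (u * rb) * (A - 1) := by gcongr
        _ = _ := by ring
    refine ⟨by linarith, ?_⟩
    by_cases e2 : (rb : ℤ) * A - ra * B = ra + rb
    swap
    · left
      exact lt_of_le_of_ne (by linarith) (Ne.symm e2)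
    right
    refine ⟨e2, ?_⟩
    have hra : (0 : ℤ) < ra := by
      rcases Nat.eq_zero_or_pos ra with h0 | h0
      · subst h0
        have hrb : (0 : ℤ) < rb := by exact_mod_cast (by omega : 0 < rb)
        have := mul_pos hrb hA
        push_cast at e2
        linarith
      · exact_mod_cast h0
    -- Equality at slope `rb / ra` forces equality at slope `v / u`. Only the alternative `j = u +
    -- v` survives, and it gives `(A - 1, B + 1) = (u, v)`, which is coprime.
    have e3 : (u : ℤ) * (B + 1) = v * (A - 1) := by
      refine le_antisymm hweak (le_of_mul_le_mul_left ?_ hra)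
      calc (ra : ℤ) * (v * (A - 1)) = (v * ra) * (A - 1) := by ring
        _ ≤ (u * rb) * (A - 1) := by gcongr
        _ = u * (rb * (A - 1)) := by ring
        _ = u * (ra * (B + 1)) := by congr 1; linarith
        _ = _ := by ring
    rcases hj with h | ⟨-, h⟩
    · linarith
    · have hsum : (A : ℤ) + B = u + v := by exact_mod_cast hjj.trans h
      have hAu : ((u : ℤ) + v) * (A - 1) = (u + v) * u := by
        have : (B : ℤ) = u + v - A := by linarith
        rw [this] at e3
        linarith
      have h1 : (A : ℤ) - 1 = u := mul_left_cancel₀ (by positivity) hAu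
      have h2 : (B : ℤ) + 1 = v := by linarith
      rw [h1, h2]
      exact_mod_cast huv
  exact ⟨⟨j, hj1, hj2, hle.1⟩, ⟨j, hj1, hj2, hle.2⟩⟩

theorem totallySymmetric_rule (s : ℕ) : TotallySymmetric s (rule s) := by
  intro w w' _ _
  refine ⟨or_comm, ?_⟩
  simp only [rule, rightRule, map_swap_map_swap]
  tauto

/-- The condition under which the site `i` of a chain of heights `K 0, …, K m` is raised by the
observation of the `s` sites on its right. -/
def RightReason (p s m : ℤ) (K : ℤ → ℤ) (i : ℤ) : Prop :=
  i + s ≤ m ∧ ((∃ j, 1 ≤ j ∧ j ≤ i ∧ K i + p ≤ K (i - j) ∧ (K (i - j) = K i + p → j = p)) ∨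
    ∀ k, 1 ≤ k → k ≤ s → K i < K (i + k))

theorem rightReason_of_rightRuleB {s : ℕ} {w w' : List Letter} {u v : ℕ} (hu : 0 < u)
    (huv : Nat.Coprime u v) (h : rightRuleB s w w') {m i : ℤ} {K : ℤ → ℤ}
    (hwi : (w.length : ℤ) ≤ i) (hwm : i + w'.length ≤ m)
    (hw : ∀ j : ℕ, j ≤ w.length → (v : ℤ) * numA w j - u * numB w j = K (i - j) - K i)
    (hw' : ∀ k : ℕ, k ≤ w'.length → (u : ℤ) * numB w' k - v * numA w' k = K (i + k) - K i) :
    RightReason (u + v) s m K i := by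
  have hs : w'.length = s := h.2.2.1
  refine ⟨by omega, ?_⟩
  rcases rightRuleB_cases hu huv h with ⟨j, hj1, hj2, hj3, hj4⟩ | h
  · left
    rw [hw j hj2] at hj3 hj4
    refine ⟨j, by omega, by omega, by omega, fun h => ?_⟩
    have := hj4 (by omega)
    omega
  · right
    intro k hk hks
    lift k to ℕ using by omega
    have h1 := h k (by omega) (by omega)
    have h2 := hw' k (by omega)
    linarith

theorem rightRuleB_of_heights {s : ℕ} {w w' : List Letter} {u v : ℕ} (hu : 0 < u) (hv : 0 < v)
    (huv : Nat.Coprime u v) (hwa : w.head? = some Letter.a) (hwb : w'.head? = some Letter.b)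
    (hs : w'.length = s) {i : ℤ} {K : ℤ → ℤ}
    (hw : ∀ j : ℕ, j ≤ w.length → (v : ℤ) * numA w j - u * numB w j = K (i - j) - K i)
    (hw' : ∀ k : ℕ, k ≤ w'.length → (u : ℤ) * numB w' k - v * numA w' k = K (i + k) - K i)
    (hlow : ∀ k, K i ≤ K k) {j : ℤ} (hj1 : 1 ≤ j) (hj2 : j ≤ w.length)
    (hj : K i + (u + v) < K (i - j) ∨ K i + (u + v) ≤ K (i - j) ∧ j = u + v) :
    rightRuleB s w w' := by
  lift j to ℕ using by omega
  refine rightRuleB_of_lowest hu hv huv hwa hwb hs (fun k hk hks => ?_) (j := j) (by omega)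
    (by omega) ?_
  · have h1 := hw' k (by omega)
    have h2 := hlow (i + k)
    linarith
  · rw [hw j (by omega)]
    omega

/-! ### Heights along a configuration and activity of its sites -/

namespace Config

variable {A B : ℕ}

theorem site_fst_add_snd (c : Config A B) {i : ℕ} (hi : i ≤ A + B) :
    (c.site i).1 + (c.site i).2 = i := by
  induction i with
  | zero => simp [c.site_zero]
  | succ i ih =>
    have h := ih (by omega)
    rw [c.site_succ i hi]
    cases c.letter (i + 1) <;> simp [Letter.vec] <;> omega

/-- The heights of the sites, indexed by the integers. They vanish outside of `[0, A + B]` when the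
heights of both ends do. -/
def profile (ta tb : ℕ) (c : Config A B) (k : ℤ) : ℤ := height ta tb (c.site k.toNat)

theorem profile_natCast (ta tb : ℕ) (c : Config A B) (k : ℕ) :
    c.profile ta tb k = height ta tb (c.site k) := rfl

theorem height_add_vec (ta tb : ℕ) (q : ℕ × ℕ) (l : Letter) :
    height ta tb (q + l.vec) = height ta tb q + (if l = Letter.a then -(tb : ℤ) else ta) := by
  cases l <;> simp [height, Letter.vec] <;> ring

theorem profile_succ (ta tb : ℕ) (c : Config A B) {i : ℕ} (hi : i < A + B) :
    c.profile ta tb (i + 1) =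
      c.profile ta tb i + (if c.letter (i + 1) = Letter.a then -(tb : ℤ) else ta) := by
  rw [profile_natCast, ← height_add_vec, ← c.site_succ i hi]
  rfl

theorem profile_pred (ta tb : ℕ) (c : Config A B) {i : ℕ} (h0 : 1 ≤ i) (hi : i ≤ A + B) :
    c.profile ta tb i =
      c.profile ta tb (i - 1) + (if c.letter i = Letter.a then -(tb : ℤ) else ta) := by
  obtain ⟨i, rfl⟩ : ∃ j, i = j + 1 := ⟨i - 1, by omega⟩
  have := c.profile_succ ta tb (i := i) (by omega)
  push_cast
  rw [this, add_sub_cancel_right]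

theorem length_rightWord (s : ℕ) (c : Config A B) (i : ℕ) :
    (c.rightWord s i).length = min s (A + B - i) := by simp [rightWord]

theorem length_leftWord (s : ℕ) (c : Config A B) (i : ℕ) :
    (c.leftWord s i).length = min s i := by simp [leftWord]

theorem count_prefix_rightWord (c : Config A B) (ta tb s : ℕ) {i k : ℕ}
    (hk : k ≤ (c.rightWord s i).length) :
    (ta : ℤ) * numB (c.rightWord s i) k - tb * numA (c.rightWord s i) k =
      c.profile ta tb (i + k) - c.profile ta tb i := by
  induction k with
  | zero => simp [numA, numB]
  | succ k ih =>
    have h := ih (by omega)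
    rw [length_rightWord] at hk
    have e : (c.rightWord s i).take (k + 1) =
        (c.rightWord s i).take k ++ [c.letter (i + k + 1)] := by
      simp only [rightWord, ← List.map_take, List.take_range]
      rw [min_eq_left hk, min_eq_left (by omega), List.range_succ]
      simp [add_right_comm]
    have hstep := c.profile_succ ta tb (i := i + k) (by omega)
    have hcast : ((i + k : ℕ) : ℤ) = i + k := by push_cast; rfl
    rw [hcast] at hstep
    simp only [numA, numB] at h ⊢
    rw [e]
    push_cast
    rw [← add_assoc, hstep]
    cases c.letter (i + k + 1) <;> simp <;> linarith

theorem count_prefix_leftWord (c : Config A B) (ta tb s : ℕ) {i k : ℕ} (hi : i ≤ A + B)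
    (hk : k ≤ (c.leftWord s i).length) :
    (tb : ℤ) * numA (c.leftWord s i) k - ta * numB (c.leftWord s i) k =
      c.profile ta tb (i - k) - c.profile ta tb i := by
  induction k with
  | zero => simp [numA, numB]
  | succ k ih =>
    have h := ih (by omega)
    rw [length_leftWord] at hk
    have e : (c.leftWord s i).take (k + 1) =
        (c.leftWord s i).take k ++ [c.letter (i - k)] := by
      simp only [leftWord, ← List.map_take, List.take_range]
      rw [min_eq_left hk, min_eq_left (by omega), List.range_succ]
      simp
    have hstep := c.profile_pred ta tb (i := i - k) (by omega) (by omega)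
    have hcast : ((i - k : ℕ) : ℤ) = i - k := by
      have : k ≤ i := by omega
      push_cast [this]; rfl
    rw [hcast] at hstep
    simp only [numA, numB] at h ⊢
    rw [e]
    push_cast
    rw [← sub_sub]
    cases hl : c.letter (i - k) <;> rw [hl] at hstep <;> simp at hstep ⊢ <;> linarith

theorem head?_rightWord (c : Config A B) {s i : ℕ} (hs : 1 ≤ s) (hi : i < A + B) :
    (c.rightWord s i).head? = some (c.letter (i + 1)) := by
  obtain ⟨l, hl⟩ : ∃ l, min s (A + B - i) = l + 1 := ⟨min s (A + B - i) - 1, by omega⟩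
  simp [rightWord, hl, List.range_succ_eq_map]

theorem head?_leftWord (c : Config A B) {s i : ℕ} (hs : 1 ≤ s) (hi : 1 ≤ i) :
    (c.leftWord s i).head? = some (c.letter i) := by
  obtain ⟨l, hl⟩ : ∃ l, min s i = l + 1 := ⟨min s i - 1, by omega⟩
  simp [leftWord, hl, List.range_succ_eq_map]

theorem active_rule_iff (c : Config A B) (s i : ℕ) : c.Active s (rule s) i ↔
    rightRuleB s (c.leftWord s i) (c.rightWord s i) ∨
    rightRuleB s ((c.leftWord s i).map Letter.swap) ((c.rightWord s i).map Letter.swap) ∨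
    rightRuleB s (c.rightWord s i) (c.leftWord s i) ∨
    rightRuleB s ((c.rightWord s i).map Letter.swap) ((c.leftWord s i).map Letter.swap) := by
  simp only [Active, rule, rightRule, or_assoc]

/-- An active site is raised or lowered. -/
theorem Active.reason {ta tb : ℕ} (hta : 0 < ta) (htb : 0 < tb) (hcop : Nat.Coprime ta tb)
    {s : ℕ} (hs : 1 ≤ s) {c : Config A B} {i : ℕ} (hi : 1 ≤ i) (him : i < A + B)
    (h : c.Active s (rule s) i) :
    (c.letter i = Letter.a ∧ c.letter (i + 1) = Letter.b ∧
      (RightReason (ta + tb) s (A + B) (c.profile ta tb) i ∨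
        RightReason (ta + tb) s (A + B) (fun k => c.profile ta tb (A + B - k)) (A + B - i))) ∨
    (c.letter i = Letter.b ∧ c.letter (i + 1) = Letter.a ∧
      (RightReason (ta + tb) s (A + B) (fun k => -c.profile ta tb k) i ∨
        RightReason (ta + tb) s (A + B) (fun k => -c.profile ta tb (A + B - k)) (A + B - i))) := by
  have hr := fun k => c.count_prefix_rightWord ta tb s (i := i) (k := k)
  have hl := fun k => c.count_prefix_leftWord ta tb s (i := i) (k := k) him.le
  have lr := c.length_rightWord s i
  have ll := c.length_leftWord s i
  have swap_eq : ∀ {l l' : Letter}, l.swap = l' → l = l'.swap := by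
    intro l l' h; rw [← h, Letter.swap_swap]
  have hm : ((A + B : ℕ) : ℤ) = A + B := by push_cast; rfl
  have e1 : (A + B : ℤ) - (A + B - i) = i := by ring
  rw [active_rule_iff] at h
  -- Exchanging the letters negates the heights, and exchanging the words reflects the chain: the
  -- four clauses are one statement applied to four height functions.
  rcases h with h | h | h | h <;> have ha := h.1 <;> have hb := h.2.1
  · rw [c.head?_leftWord hs hi] at ha
    rw [c.head?_rightWord hs him] at hb
    refine Or.inl ⟨Option.some_inj.1 ha, Option.some_inj.1 hb, Or.inl ?_⟩
    exact rightReason_of_rightRuleB hta hcop h (by omega) (by omega) hl hr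
  · rw [List.head?_map, c.head?_leftWord hs hi] at ha
    rw [List.head?_map, c.head?_rightWord hs him] at hb
    refine Or.inr ⟨swap_eq (Option.some_inj.1 ha), swap_eq (Option.some_inj.1 hb), Or.inl ?_⟩
    rw [add_comm (ta : ℤ)]
    refine rightReason_of_rightRuleB htb hcop.symm h ?_ ?_ ?_ ?_ <;>
      simp only [List.length_map, numA_map_swap, numB_map_swap]
    · omega
    · omega
    · intro j hj; linarith [hl j hj]
    · intro j hj; linarith [hr j hj]
  · rw [c.head?_rightWord hs him] at ha
    rw [c.head?_leftWord hs hi] at hb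
    refine Or.inr ⟨Option.some_inj.1 hb, Option.some_inj.1 ha, Or.inr ?_⟩
    refine rightReason_of_rightRuleB hta hcop h (by omega) (by omega) ?_ ?_
    · intro j hj
      have e2 : (A + B : ℤ) - (A + B - i - j) = i + j := by ring
      simp only [e1, e2]
      linarith [hr j hj]
    · intro j hj
      have e2 : (A + B : ℤ) - (A + B - i + j) = i - j := by ring
      simp only [e1, e2]
      linarith [hl j hj]
  · rw [List.head?_map, c.head?_rightWord hs him] at ha
    rw [List.head?_map, c.head?_leftWord hs hi] at hb
    refine Or.inl ⟨swap_eq (Option.some_inj.1 hb), swap_eq (Option.some_inj.1 ha), Or.inr ?_⟩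
    rw [add_comm (ta : ℤ)]
    refine rightReason_of_rightRuleB htb hcop.symm h ?_ ?_ ?_ ?_ <;>
      simp only [List.length_map, numA_map_swap, numB_map_swap]
    · omega
    · omega
    · intro j hj
      have e2 : (A + B : ℤ) - (A + B - i - j) = i + j := by ring
      simp only [e1, e2]
      linarith [hr j hj]
    · intro j hj
      have e2 : (A + B : ℤ) - (A + B - i + j) = i - j := by ring
      simp only [e1, e2]
      linarith [hl j hj]

/-- A highest site is active if, on the side opposite to a full sight, it sees a site that is low
enough. -/
theorem active_of_highest {ta tb : ℕ} (hta : 0 < ta) (htb : 0 < tb) (hcop : Nat.Coprime ta tb)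
    {s : ℕ} (hs : 1 ≤ s) {c : Config A B} {i : ℕ} (hi : 1 ≤ i) (him : i < A + B)
    (hmax : ∀ k, c.profile ta tb k ≤ c.profile ta tb i) {j : ℤ} (hj1 : 1 ≤ j) (hjs : j ≤ s)
    (h : (i + s ≤ A + B ∧ j ≤ i ∧ (c.profile ta tb (i - j) < c.profile ta tb i - (ta + tb) ∨
        c.profile ta tb (i - j) ≤ c.profile ta tb i - (ta + tb) ∧ j = ta + tb)) ∨
      (s ≤ i ∧ i + j ≤ A + B ∧ (c.profile ta tb (i + j) < c.profile ta tb i - (ta + tb) ∨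
        c.profile ta tb (i + j) ≤ c.profile ta tb i - (ta + tb) ∧ j = ta + tb))) :
    c.Active s (rule s) i := by
  have hr := fun k => c.count_prefix_rightWord ta tb s (i := i) (k := k)
  have hl := fun k => c.count_prefix_leftWord ta tb s (i := i) (k := k) him.le
  have lr := c.length_rightWord s i
  have ll := c.length_leftWord s i
  have e1 : (A + B : ℤ) - (A + B - i) = i := by ring
  have hb : c.letter i = Letter.b := by
    have h1 := c.profile_pred ta tb hi him.le
    have h2 := hmax (i - 1)
    cases hc : c.letter i with
    | a => rw [hc] at h1; simp at h1; omega
    | b => rfl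
  have ha : c.letter (i + 1) = Letter.a := by
    have h1 := c.profile_succ ta tb him
    have h2 := hmax (i + 1)
    cases hc : c.letter (i + 1) with
    | a => rfl
    | b => rw [hc] at h1; simp at h1; omega
  have hr' := c.head?_rightWord hs him
  have hl' := c.head?_leftWord hs hi
  rw [ha] at hr'
  rw [hb] at hl'
  rw [active_rule_iff]
  rcases h with ⟨h1, h2, h3⟩ | ⟨h1, h2, h3⟩
  · right; left
    refine rightRuleB_of_heights htb hta hcop.symm (by simp [hl', Letter.swap])
      (by simp [hr', Letter.swap]) (by simp; omega) (i := i) (K := fun k => -c.profile ta tb k)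
      ?_ ?_ ?_ hj1 ?_ ?_ <;> try simp only [List.length_map, numA_map_swap, numB_map_swap]
    · intro j hj; linarith [hl j hj]
    · intro j hj; linarith [hr j hj]
    · intro k; linarith [hmax k]
    · omega
    · omega
  · right; right; left
    refine rightRuleB_of_heights hta htb hcop hr' hl' (by omega) (i := A + B - i)
      (K := fun k => -c.profile ta tb (A + B - k)) ?_ ?_ ?_ hj1 ?_ ?_
    · intro j hj
      have e2 : (A + B : ℤ) - (A + B - i - j) = i + j := by ring
      simp only [e1, e2]
      linarith [hr j hj]
    · intro j hj
      have e2 : (A + B : ℤ) - (A + B - i + j) = i - j := by ring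
      simp only [e1, e2]
      linarith [hl j hj]
    · intro k
      simp only [e1]
      linarith [hmax (A + B - k)]
    · omega
    · have e2 : (A + B : ℤ) - (A + B - i - j) = i + j := by ring
      simp only [e1, e2]
      omega

theorem profile_flip_of_ne (ta tb : ℕ) (c : Config A B) {i : ℕ} {k : ℤ} (hi : 1 ≤ i) (hk : k ≠ i) :
    (c.flip i).profile ta tb k = c.profile ta tb k := by
  unfold profile flip
  split_ifs
  · simp only
    rw [Function.update_of_ne (by omega)]
  · rfl

theorem profile_flip_self (ta tb : ℕ) (c : Config A B) {i : ℕ} (hi : 1 ≤ i) (him : i < A + B) :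
    (c.flip i).profile ta tb i = c.profile ta tb (i - 1) +
      (if c.letter (i + 1) = Letter.a then -(tb : ℤ) else ta) := by
  have e : ((i : ℤ) - 1).toNat = i - 1 := by omega
  simp only [profile, flip, hi, him, and_self, dite_true, Int.toNat_natCast, Function.update_self,
    height_add_vec, e]

end Config

/-! ### Runs in a finite set of integers -/

section Runs

open Classical in
/-- The number of endpoints `k`, `k + p` of the intervals that start or end in `S`. -/
noncomputable def spread (S : Finset ℤ) (p : ℤ) : ℕ := (S ∪ S.image (· + p)).card

open Classical in
/-- The number of elements among `k - p`, `k + p` that are not in `S`. -/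
noncomputable def vacancies (S : Finset ℤ) (p k : ℤ) : ℕ :=
  (if k - p ∈ S then 0 else 1) + (if k + p ∈ S then 0 else 1)

open Classical in
-- The endpoint `k` is new unless `k - p ∈ S`, and the endpoint `k + p` is new unless `k + p ∈ S`. A
-- change inside a run thus costs nothing.
theorem spread_insert {S : Finset ℤ} {p k : ℤ} (hp : p ≠ 0) (hk : k ∉ S) :
    spread (insert k S) p = spread S p + vacancies S p k := by
  have e : insert k S ∪ (insert k S).image (· + p) =
      insert k (insert (k + p) (S ∪ S.image (· + p))) := by
    ext x; simp; tauto
  have h1 : k + p ∈ S ∪ S.image (· + p) ↔ k + p ∈ S := by simp [hk]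
  have h2 : k ∈ insert (k + p) (S ∪ S.image (· + p)) ↔ k - p ∈ S := by
    simp only [Finset.mem_insert, Finset.mem_union, hk, Finset.mem_image, false_or]
    constructor
    · rintro (h | ⟨x, hx, rfl⟩)
      · omega
      · simpa using hx
    · intro h
      exact Or.inr ⟨_, h, by ring⟩
  rw [spread, spread, vacancies, e, Finset.card_insert_eq_ite, Finset.card_insert_eq_ite]
  simp only [h1, h2]
  split_ifs <;> omega

open Classical in
theorem spread_erase {S : Finset ℤ} {p k : ℤ} (hp : p ≠ 0) (hk : k ∈ S) :
    spread (S.erase k) p + vacancies S p k = spread S p := by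
  have h := spread_insert hp (Finset.notMem_erase k S)
  rw [Finset.insert_erase hk] at h
  rw [h]
  congr 1
  simp [vacancies, hp]

theorem exists_end (S : Finset ℤ) {d : ℤ} (hd : d ≠ 0) {k : ℤ} (hk : k ∈ S) :
    ∃ l : ℕ, (∀ j : ℕ, j ≤ l → k + j * d ∈ S) ∧ k + (l + 1) * d ∉ S := by
  classical
  have hex : ∃ l : ℕ, k + ((l : ℤ) + 1) * d ∉ S := by
    by_contra! hall
    have hinj : Function.Injective (fun l : ℕ => k + ((l : ℤ) + 1) * d) := by
      intro x y hxy
      have : ((x : ℤ) + 1) * d = (y + 1) * d := by simpa using hxy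
      have := mul_right_cancel₀ hd this
      omega
    exact Set.infinite_of_injective_forall_mem hinj (s := (S : Set ℤ)) hall S.finite_toSet
  refine ⟨Nat.find hex, fun j hj => ?_, Nat.find_spec hex⟩
  cases j with
  | zero => simpa using hk
  | succ j =>
    have := Nat.find_min hex (m := j) (by omega)
    push_cast
    exact not_not.1 this

variable {S : Finset ℤ} {U D : ℤ → Prop}

open Classical in
-- Each inactive end is sent to the opposite end of its run. This is injective because a run has
-- only one end in the direction `d`.
theorem card_inactive_ends_le {d : ℤ} (hd : d ≠ 0)
    (h : ∀ k ∈ S, k + d ∉ S → ¬ D k → ∀ l : ℕ, (∀ j : ℕ, j ≤ l → k - j * d ∈ S) →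
      k - (l + 1) * d ∉ S →
      D (k - l * d) ∧ ¬ (U (k - (l + 1) * d) ∧ k - (l + 2) * d ∉ S)) :
    (S.filter fun k => k + d ∉ S ∧ ¬ D k).card ≤
      (S.filter fun k => k - d ∉ S ∧ D k ∧ ¬ (U (k - d) ∧ k - 2 * d ∉ S)).card := by
  have hend : ∀ k, ∃ l : ℕ, k ∈ S →
      (∀ j : ℕ, j ≤ l → k - j * d ∈ S) ∧ k - (l + 1) * d ∉ S := by
    intro k
    by_cases hk : k ∈ S
    · obtain ⟨l, h1, h2⟩ := exists_end S (neg_ne_zero.2 hd) hk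
      refine ⟨l, fun _ => ⟨fun j hj => ?_, ?_⟩⟩
      · have := h1 j hj
        rwa [mul_neg, ← sub_eq_add_neg] at this
      · rwa [mul_neg, ← sub_eq_add_neg] at h2
    · exact ⟨0, fun h => absurd h hk⟩
  choose l hl using hend
  refine Finset.card_le_card_of_injOn (fun k => k - l k * d) ?_ ?_
  · intro k hk
    simp only [Finset.coe_filter, Set.mem_ofPred_eq] at hk ⊢
    obtain ⟨h1, h2⟩ := hl k hk.1
    obtain ⟨h3, h4⟩ := h k hk.1 hk.2.1 hk.2.2 (l k) h1 h2
    have e1 : k - l k * d - d = k - (l k + 1) * d := by ring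
    have e2 : k - l k * d - 2 * d = k - (l k + 2) * d := by ring
    rw [e1, e2]
    exact ⟨h1 _ le_rfl, h2, h3, h4⟩
  · have key : ∀ k k', k ∈ S → k' ∈ S → k + d ∉ S → k - l k * d = k' - l k' * d →
        ¬ l k < l k' := by
      intro k k' _ hk' hd' heq hlt
      refine hd' ?_
      have := (hl k' hk').1 (l k' - l k - 1) (by omega)
      have e : ((l k' - l k - 1 : ℕ) : ℤ) = l k' - l k - 1 := by omega
      rw [e] at this
      have e2 : k' - ((l k' : ℤ) - l k - 1) * d = k + d := by linarith
      rwa [e2] at this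
    intro k hk k' hk' heq
    simp only [Finset.coe_filter, Set.mem_ofPred_eq] at hk hk' heq
    have h1 := key k k' hk.1 hk'.1 hk.2.1 heq
    have h2 := key k' k hk'.1 hk.1 hk'.2.1 heq.symm
    have h3 : l k = l k' := by omega
    rw [h3] at heq
    linarith

open Classical in
-- The ends that can grow and the active ends that cannot are disjoint families of ends in the
-- direction `d`.
theorem card_raised_add_le (S : Finset ℤ) (U D : ℤ → Prop) (d : ℤ) :
    (S.filter fun k => k + d ∉ S ∧ U (k + d) ∧ k + 2 * d ∉ S).card +
      (S.filter fun k => k + d ∉ S ∧ D k ∧ ¬ (U (k + d) ∧ k + 2 * d ∉ S)).card ≤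
    (S.filter fun k => k + d ∉ S ∧ D k).card + (S.filter fun k => k + d ∉ S ∧ ¬ D k).card := by
  have h1 : (S.filter fun k => k + d ∉ S ∧ D k).card + (S.filter fun k => k + d ∉ S ∧ ¬ D k).card =
      (S.filter fun k => k + d ∉ S).card := by
    rw [← Finset.card_filter_add_card_filter_not (s := S.filter fun k => k + d ∉ S) D,
      Finset.filter_filter, Finset.filter_filter]
  rw [h1, ← Finset.card_union_of_disjoint]
  · refine Finset.card_le_card fun k => ?_
    simp only [Finset.mem_union, Finset.mem_filter]
    tauto
  · rw [Finset.disjoint_filter]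
    tauto

open Classical in
/-- If inactive ends of runs are compensated at the opposite ends, then the number of raised
sites is at most the number of lowered sites, both counted with their vacancies. -/
theorem sum_vacancies_le {p : ℤ} (hp : p ≠ 0) {T : Finset ℤ} (hS : S ⊆ T)
    (hU : ∀ k, U k → k - p ∈ S ∨ k + p ∈ S)
    (h : ∀ d, d = p ∨ d = -p → ∀ k ∈ S, k + d ∉ S → ¬ D k → ∀ l : ℕ,
      (∀ j : ℕ, j ≤ l → k - j * d ∈ S) → k - (l + 1) * d ∉ S →
      D (k - l * d) ∧ ¬ (U (k - (l + 1) * d) ∧ k - (l + 2) * d ∉ S)) :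
    ∑ k ∈ T, (if k ∈ S then (if D k then -(vacancies S p k : ℤ) else 0)
      else (if U k then (vacancies S p k : ℤ) else 0)) ≤ 0 := by
  -- In the sum of these four inequalities, the inactive ends on each side cancel against the active
  -- non-growing ends on the other side. What remains is that growths are at most as many as active
  -- ends.
  have i1 := card_inactive_ends_le hp (h p (Or.inl rfl))
  have i2 := card_inactive_ends_le (neg_ne_zero.2 hp) (h (-p) (Or.inr rfl))
  have b1 := card_raised_add_le S U D p
  have b2 := card_raised_add_le S U D (-p)
  simp only [mul_neg, sub_neg_eq_add, ← sub_eq_add_neg] at i1 i2 b1 b2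
  have down : ∑ k ∈ S, (if D k then (vacancies S p k) else 0) =
      (S.filter fun k => k + p ∉ S ∧ D k).card + (S.filter fun k => k - p ∉ S ∧ D k).card := by
    rw [Finset.card_filter, Finset.card_filter, ← Finset.sum_add_distrib]
    refine Finset.sum_congr rfl fun k _ => ?_
    unfold vacancies
    by_cases h1 : k - p ∈ S <;> by_cases h2 : k + p ∈ S <;> by_cases h3 : D k <;>
      simp [h1, h2, h3]
  -- A raised site touches a run, so it has at most one vacancy. If it has one, it is charged to its
  -- unique neighbour in `S`, an end of a run.
  have up : ∑ k ∈ T \ S, (if U k then (vacancies S p k) else 0) ≤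
      (S.filter fun k => k + p ∉ S ∧ U (k + p) ∧ k + 2 * p ∉ S).card +
        (S.filter fun k => k - p ∉ S ∧ U (k - p) ∧ k - 2 * p ∉ S).card := by
    have c1 : ((T \ S).filter fun k => U k ∧ k - p ∈ S ∧ k + p ∉ S).card ≤
        (S.filter fun k => k + p ∉ S ∧ U (k + p) ∧ k + 2 * p ∉ S).card := by
      refine Finset.card_le_card_of_injOn (· - p) ?_ (sub_left_injective.injOn)
      intro k hk
      simp only [Finset.coe_filter, Set.mem_ofPred_eq, Finset.mem_sdiff] at hk ⊢
      have e : k - p + 2 * p = k + p := by ring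
      rw [sub_add_cancel, e]
      tauto
    have c2 : ((T \ S).filter fun k => U k ∧ k + p ∈ S ∧ k - p ∉ S).card ≤
        (S.filter fun k => k - p ∉ S ∧ U (k - p) ∧ k - 2 * p ∉ S).card := by
      refine Finset.card_le_card_of_injOn (· + p) ?_ ((add_left_injective p).injOn)
      intro k hk
      simp only [Finset.coe_filter, Set.mem_ofPred_eq, Finset.mem_sdiff] at hk ⊢
      have e : k + p - 2 * p = k - p := by ring
      rw [add_sub_cancel_right, e]
      tauto
    refine le_trans (le_of_eq ?_) (add_le_add c1 c2)
    rw [Finset.card_filter, Finset.card_filter, ← Finset.sum_add_distrib]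
    refine Finset.sum_congr rfl fun k _ => ?_
    unfold vacancies
    have := hU k
    by_cases h1 : k - p ∈ S <;> by_cases h2 : k + p ∈ S <;> by_cases h3 : U k <;>
      simp [h1, h2, h3]
    exact absurd (this h3) (by tauto)
  rw [← Finset.sum_sdiff hS]
  have e1 : ∑ k ∈ T \ S, (if k ∈ S then (if D k then -(vacancies S p k : ℤ) else 0)
      else (if U k then (vacancies S p k : ℤ) else 0)) =
      ((∑ k ∈ T \ S, (if U k then (vacancies S p k) else 0) : ℕ) : ℤ) := by
    push_cast
    refine Finset.sum_congr rfl fun k hk => ?_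
    rw [if_neg (Finset.mem_sdiff.1 hk).2]
  have e2 : ∑ k ∈ S, (if k ∈ S then (if D k then -(vacancies S p k : ℤ) else 0)
      else (if U k then (vacancies S p k : ℤ) else 0)) =
      -((∑ k ∈ S, (if D k then (vacancies S p k) else 0) : ℕ) : ℤ) := by
    push_cast
    rw [← Finset.sum_neg_distrib]
    refine Finset.sum_congr rfl fun k hk => ?_
    rw [if_pos hk]
    split_ifs <;> simp
  rw [e1, e2]
  omega

/-- In any run, the upper end or the lower end is active. This keeps the variance of the drift away
from zero. -/
theorem exists_active_end {p : ℤ} (hp : p ≠ 0) (hS : S.Nonempty)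
    (h : ∀ k ∈ S, k + p ∉ S → ¬ D k → ∀ l : ℕ,
      (∀ j : ℕ, j ≤ l → k - j * p ∈ S) → k - (l + 1) * p ∉ S → D (k - l * p)) :
    ∃ k ∈ S, D k ∧ 1 ≤ vacancies S p k := by
  obtain ⟨k₀, hk₀⟩ := hS
  obtain ⟨l₀, h1, h2⟩ := exists_end S hp hk₀
  set k := k₀ + l₀ * p with hk
  have hkS : k ∈ S := h1 _ le_rfl
  have hkp : k + p ∉ S := by rwa [hk, add_assoc, ← add_one_mul]
  by_cases hD : D k
  · exact ⟨k, hkS, hD, by simp [vacancies, hkp]⟩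
  · obtain ⟨l, h3, h4⟩ := exists_end S (neg_ne_zero.2 hp) hkS
    simp only [mul_neg, ← sub_eq_add_neg] at h3 h4
    refine ⟨k - l * p, h3 _ le_rfl, h k hkS hkp hD l h3 h4, ?_⟩
    have e : k - l * p - p = k - (l + 1) * p := by ring
    simp [vacancies, e, h4]

end Runs

/-! ### The highest level of a chain -/

theorem add_le_of_dvd_sub {p x y : ℤ} (hd : p ∣ x - y) (hxy : x < y) : x + p ≤ y := by
  have := Int.le_of_dvd (by omega) ((dvd_sub_comm).1 hd)
  omega

/-- A chain of heights `H 0, …, H m`, with the properties of its transitions `up`, `dn` to and from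
its highest level `M` that do not depend on its orientation. -/
structure LevelData (p s m M : ℤ) (H : ℤ → ℤ) (up dn : ℤ → Prop) : Prop where
  p_pos : 0 < p
  p_le_s : p ≤ s
  sight : 2 * s ≤ m + 1
  p_le_M : p ≤ M
  p_dvd_m : p ∣ m
  left : ∀ i, i ≤ 0 → H i = 0
  right : ∀ i, m ≤ i → H i = 0
  le : ∀ i, H i ≤ M
  dvd_step : ∀ i, 0 ≤ i → i + p ≤ m → p ∣ H (i + p) - H i
  dvd_index : ∀ i, 0 ≤ i → i ≤ m → p ∣ H i → p ∣ i
  up_reason : ∀ i, 1 ≤ i → i < m → up i → H i = M - p →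
    RightReason p s m H i ∨ RightReason p s m (fun k => H (m - k)) (m - i)
  dn_of_low : ∀ i j, 1 ≤ i → i < m → H i = M → 1 ≤ j → j ≤ s →
    ((i + s ≤ m ∧ j ≤ i ∧ (H (i - j) < M - p ∨ H (i - j) ≤ M - p ∧ j = p)) ∨
      (s ≤ i ∧ i + j ≤ m ∧ (H (i + j) < M - p ∨ H (i + j) ≤ M - p ∧ j = p))) → dn i

namespace LevelData

variable {p s m M : ℤ} {H : ℤ → ℤ} {up dn : ℤ → Prop}

/-- Reversing the chain exchanges upper and lower ends of runs, so that only one orientation has to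
be studied. -/
theorem reflect (h : LevelData p s m M H up dn) :
    LevelData p s m M (fun k => H (m - k)) (fun k => up (m - k)) (fun k => dn (m - k)) where
  p_pos := h.p_pos
  p_le_s := h.p_le_s
  sight := h.sight
  p_le_M := h.p_le_M
  p_dvd_m := h.p_dvd_m
  left i hi := h.right _ (by omega)
  right i hi := h.left _ (by omega)
  le i := h.le _
  dvd_step i hi hi' := by
    have := h.dvd_step (m - (i + p)) (by omega) (by omega)
    have e : m - (i + p) + p = m - i := by ring
    rw [e] at this
    exact (dvd_sub_comm).1 this
  dvd_index i hi hi' hd := by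
    have := dvd_sub h.p_dvd_m (h.dvd_index (m - i) (by omega) (by omega) hd)
    rwa [sub_sub_cancel] at this
  up_reason i hi hi' hu hM := by
    have := h.up_reason (m - i) (by omega) (by omega) hu hM
    simp only [sub_sub_cancel] at this ⊢
    exact this.symm
  dn_of_low i j hi hi' hM hj hj' hlow := by
    refine h.dn_of_low (m - i) j (by omega) (by omega) hM hj hj' ?_
    have e1 : m - (i - j) = m - i + j := by ring
    have e2 : m - (i + j) = m - i - j := by ring
    simp only [e1, e2] at hlow
    rcases hlow with ⟨h1, h2, h3⟩ | ⟨h1, h2, h3⟩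
    · exact Or.inr ⟨by omega, by omega, h3⟩
    · exact Or.inl ⟨by omega, by omega, h3⟩

theorem pos_of_highest (h : LevelData p s m M H up dn) {k : ℤ} (hk : H k = M) : 1 ≤ k ∧ k < m := by
  have h1 := h.p_pos
  have h2 := h.p_le_M
  constructor
  · by_contra hc
    have := h.left k (by omega)
    omega
  · by_contra hc
    have := h.right k (by omega)
    omega

theorem le_add_of_vacant (h : LevelData p s m M H up dn) {k : ℤ} (hk : H k = M)
    (hk' : H (k + p) ≠ M) (hm : k + p ≤ m) : H (k + p) ≤ M - p := by
  have h1 := h.pos_of_highest hk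
  have h2 := h.dvd_step k (by omega) hm
  have h3 := h.le (k + p)
  have := add_le_of_dvd_sub h2 (by omega)
  omega

theorem le_sub_of_vacant (h : LevelData p s m M H up dn) {k : ℤ} (hk : H k = M)
    (hk' : H (k - p) ≠ M) (hm : p ≤ k) : H (k - p) ≤ M - p := by
  have h1 := h.pos_of_highest hk
  have h2 := h.dvd_step (k - p) (by omega) (by omega)
  have h3 := h.le (k - p)
  rw [sub_add_cancel] at h2
  have := add_le_of_dvd_sub ((dvd_sub_comm).1 h2) (by omega)
  omega

/-- An upper end of a run of highest sites can only be inactive when `M = p` and it has no full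
sight on its left; then the lower end of the run is active, and the run does not grow there. -/
theorem inactive_end (h : LevelData p s m M H up dn) {k : ℤ} (hk : H k = M) (hk' : H (k + p) ≠ M)
    (hD : ¬ dn k) {l : ℕ} (hl : H (k - l * p) = M) (hl' : H (k - (l + 1) * p) ≠ M) :
    dn (k - l * p) ∧ ¬ ((1 ≤ k - (l + 1) * p ∧ k - (l + 1) * p < m ∧ up (k - (l + 1) * p) ∧
      H (k - (l + 1) * p) = M - p) ∧ H (k - (l + 2) * p) ≠ M) := by
  have hp := h.p_pos
  have hps := h.p_le_s
  have hs := h.sight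
  have hM := h.p_le_M
  obtain ⟨hk1, hkm⟩ := h.pos_of_highest hk
  obtain ⟨hl1, hlm⟩ := h.pos_of_highest hl
  have hdvd : ∀ i, M = p → H i = M → p ∣ i := by
    intro i hMp hi
    have := h.pos_of_highest hi
    exact h.dvd_index i (by omega) (by omega) (by rw [hi, hMp])
  -- With a full sight on the left, `k` would be lowered because of `k + p`, or because of the end
  -- `m`, at height `0`, if `k + p` lies beyond it. The latter needs `p < M`; but for `M = p` both
  -- `k` and `m` are multiples of `p`, so `k + p ≤ m`.
  have hks : k < s := by
    by_contra hc
    refine hD ?_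
    by_cases hpm : k + p ≤ m
    · refine h.dn_of_low k p hk1 hkm hk (by omega) hps (Or.inr ⟨by omega, hpm, Or.inr ⟨?_, rfl⟩⟩)
      exact h.le_add_of_vacant hk hk' hpm
    · refine h.dn_of_low k (m - k) hk1 hkm hk (by omega) (by omega)
        (Or.inr ⟨by omega, by omega, Or.inl ?_⟩)
      rw [add_sub_cancel, h.right m le_rfl]
      have : M ≠ p := by
        intro hMp
        have := Int.le_of_dvd (by omega) (dvd_sub h.p_dvd_m (hdvd k hMp hk))
        omega
      omega
  -- Since `2 * s ≤ m + 1`, the inequality `k < s` gives a full sight on the right. The origin, at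
  -- height `0`, is visible on the left and would make `k` active if `p < M`.
  have hMp : M = p := by
    by_contra hc
    refine hD (h.dn_of_low k k hk1 hkm hk hk1 hks.le (Or.inl ⟨by omega, le_rfl, Or.inl ?_⟩))
    rw [sub_self, h.left 0 le_rfl]
    omega
  have hlk : 0 ≤ (l : ℤ) * p := by positivity
  have hk1p := hdvd _ hMp hl
  have e1 : k - (l + 1) * p = k - l * p - p := by ring
  have e2 : k - (l + 2) * p = k - l * p - p - p := by ring
  rw [e1] at hl' ⊢
  rw [e2]
  have hk1k : k - l * p ≤ k := by omega
  generalize k - l * p = k₁ at *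
  have hk1p' := Int.le_of_dvd (by omega) hk1p
  refine ⟨?_, ?_⟩
  · refine h.dn_of_low k₁ p hl1 hlm hl (by omega) hps
      (Or.inl ⟨by omega, hk1p', Or.inr ⟨?_, rfl⟩⟩)
    exact h.le_sub_of_vacant hl hl' hk1p'
  -- The site `q = k₁ - p` is a positive multiple of `p`. A higher site on its left would have to be
  -- `q - p`, at height `M`, which is excluded. Strictly higher sites all along its right sight
  -- would include `k + p`, visible because `p ≤ q` and `k < s`, but too low. The mirrored reason
  -- needs `s ≤ q`.
  · rintro ⟨⟨hq1, hqm, hup, hq⟩, hq'⟩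
    have hqp := Int.le_of_dvd (by omega) (dvd_sub hk1p (dvd_refl p))
    rcases h.up_reason _ hq1 hqm hup hq with ⟨-, ⟨j, hj1, hj2, hj3, hj4⟩ | hall⟩ | ⟨hsm, -⟩
    · have := h.le (k₁ - p - j)
      have := hj4 (by omega)
      rw [this] at hj3
      have := h.le (k₁ - p - p)
      omega
    · have h1 := hall (k + p - (k₁ - p)) (by omega) (by omega)
      rw [add_sub_cancel] at h1
      have := h.le_add_of_vacant hk hk' (by omega)
      omega
    · omega

/-- From height `M - p`, a thickness witness can only be an equality, hence at distance exactly `p`.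
In the other case the neighbour at distance `p` is strictly higher, and by divisibility it is at
height `M`. -/
theorem raised_adjacent (h : LevelData p s m M H up dn) {i : ℤ} (hi : 1 ≤ i) (hi' : i < m)
    (hu : up i) (hM : H i = M - p) : H (i - p) = M ∨ H (i + p) = M := by
  have key : ∀ {H' : ℤ → ℤ} {up' dn' : ℤ → Prop} {i' : ℤ}, LevelData p s m M H' up' dn' →
      1 ≤ i' → RightReason p s m H' i' → H' i' = M - p → H' (i' - p) = M ∨ H' (i' + p) = M := by
    rintro H' up' dn' i' h' hi' ⟨h1, ⟨j, hj1, hj2, hj3, hj4⟩ | hall⟩ hM'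
    · left
      have := h'.le (i' - j)
      have hj := hj4 (by omega)
      rw [hj] at hj3
      have := h'.le (i' - p)
      omega
    · right
      have hp := h'.p_pos
      have hps := h'.p_le_s
      have h2 := hall p (by omega) hps
      have h3 := h'.dvd_step i' (by omega) (by omega)
      have h4 := h'.le (i' + p)
      have h5 := add_le_of_dvd_sub ((dvd_sub_comm).1 h3) h2
      omega
  rcases h.up_reason i hi hi' hu hM with hr | hr
  · exact key h hi hr hM
  · have := key h.reflect (by omega) hr (by simpa using hM)
    have e1 : m - (m - i - p) = i + p := by ring
    have e2 : m - (m - i + p) = i - p := by ring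
    simp only [e1, e2] at this
    exact this.symm

/-- `inactive_end` and its mirror image, for the set `S` of the highest sites. -/
theorem inactive_end_of_levelSet (h : LevelData p s m M H up dn) {S : Finset ℤ}
    (hS : ∀ k, k ∈ S ↔ H k = M) (d : ℤ) (hd : d = p ∨ d = -p) :
    ∀ k ∈ S, k + d ∉ S → ¬ dn k → ∀ l : ℕ,
      (∀ j : ℕ, j ≤ l → k - j * d ∈ S) → k - (l + 1) * d ∉ S →
      dn (k - l * d) ∧ ¬ ((1 ≤ k - (l + 1) * d ∧ k - (l + 1) * d < m ∧ up (k - (l + 1) * d) ∧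
        H (k - (l + 1) * d) = M - p) ∧ k - (l + 2) * d ∉ S) := by
  intro k hk hk' hD l hl hl'
  have hl := hl l le_rfl
  simp only [hS] at hk hk' hl hl' ⊢
  rcases hd with rfl | rfl
  · exact h.inactive_end hk hk' hD hl hl'
  · have e1 : m - (m - k + p) = k + -p := by ring
    have e2 : m - (m - k - l * p) = k - l * -p := by ring
    have e3 : m - (m - k - (l + 1) * p) = k - (l + 1) * -p := by ring
    have e4 : m - (m - k - (l + 2) * p) = k - (l + 2) * -p := by ring
    have := h.reflect.inactive_end (k := m - k) (l := l) (by simpa using hk) (by rwa [e1])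
      (by simpa using hD) (by rwa [e2]) (by rwa [e3])
    rw [e2, e3, e4] at this
    refine ⟨this.1, fun hc => this.2 ⟨⟨?_, ?_, hc.1.2.2⟩, hc.2⟩⟩
    · have := hc.1.2.1
      linarith
    · have := hc.1.1
      linarith

end LevelData

/-- When all visible sites are strictly higher, the one at distance `p` is visible and higher by a
multiple of `p`. Hence a flip, which moves a height by `p`, never leaves the current range of
heights. -/
theorem RightReason.exists_le {p s m i : ℤ} {K : ℤ → ℤ} (hp : 0 < p) (hs : p ≤ s) (hi : 0 ≤ i)
    (hd : ∀ i, 0 ≤ i → i + p ≤ m → p ∣ K (i + p) - K i) (h : RightReason p s m K i) :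
    ∃ k, K i + p ≤ K k := by
  obtain ⟨h1, ⟨j, -, -, hj, -⟩ | hall⟩ := h
  · exact ⟨_, hj⟩
  · exact ⟨_, add_le_of_dvd_sub ((dvd_sub_comm).1 (hd i hi (by omega))) (hall p (by omega) hs)⟩

/-! ### Effect of one step on the heights -/

namespace Config

variable {A B : ℕ}

theorem profile_of_le_zero (ta tb : ℕ) (c : Config A B) {k : ℤ} (hk : k ≤ 0) :
    c.profile ta tb k = 0 := by
  have : k.toNat = 0 := by omega
  simp [profile, this, c.site_zero, height]

theorem profile_of_ge {ta tb : ℕ} (hAB : tb * A = ta * B) (c : Config A B) {k : ℤ}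
    (hk : (A + B : ℤ) ≤ k) : c.profile ta tb k = 0 := by
  have hAB' : (tb : ℤ) * A = ta * B := by exact_mod_cast hAB
  rw [profile, c.site_of_ge _ (by omega)]
  simp only [height]
  linarith

/-- Modulo `ta + tb` the height depends only on the index; the divisibility properties of the
heights follow from this. -/
theorem exists_profile_eq (ta tb : ℕ) (c : Config A B) {k : ℤ} (hk : 0 ≤ k)
    (hk' : k ≤ A + B) : ∃ x : ℤ, c.profile ta tb k = ta * k - (ta + tb) * x := by
  lift k to ℕ using hk
  refine ⟨(c.site k).1, ?_⟩
  have h : (((c.site k).1 : ℤ) + (c.site k).2) = k := by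
    exact_mod_cast c.site_fst_add_snd (by omega)
  rw [profile_natCast, ← h, height]
  ring

theorem dvd_profile_add_sub (ta tb : ℕ) (c : Config A B) {k : ℤ} (hk : 0 ≤ k)
    (hk' : k + (ta + tb) ≤ A + B) :
    (ta + tb : ℤ) ∣ c.profile ta tb (k + (ta + tb)) - c.profile ta tb k := by
  obtain ⟨x, hx⟩ := c.exists_profile_eq ta tb hk (by omega)
  obtain ⟨y, hy⟩ := c.exists_profile_eq ta tb (k := k + (ta + tb)) (by omega) hk'
  exact ⟨ta - y + x, by rw [hx, hy]; ring⟩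

theorem dvd_of_dvd_profile {ta tb : ℕ} (hcop : Nat.Coprime ta tb) (c : Config A B) {k : ℤ}
    (hk : 0 ≤ k) (hk' : k ≤ A + B) (h : (ta + tb : ℤ) ∣ c.profile ta tb k) :
    (ta + tb : ℤ) ∣ k := by
  obtain ⟨x, hx⟩ := c.exists_profile_eq ta tb hk hk'
  rw [hx] at h
  have h1 : (ta + tb : ℤ) ∣ ta * k := by
    have := dvd_add h (dvd_mul_right (ta + tb : ℤ) x)
    rwa [sub_add_cancel] at this
  refine IsCoprime.dvd_of_dvd_mul_left ?_ h1
  have h2 : Nat.Coprime (ta + tb) ta := by simpa using hcop.symm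
  exact_mod_cast Nat.isCoprime_iff_coprime.2 h2

/-- The possible effects of one step of the process. -/
theorem update_cases {ta tb : ℕ} (hta : 0 < ta) (htb : 0 < tb) (hcop : Nat.Coprime ta tb)
    {s : ℕ} (hs : ta + tb ≤ s) (c : Config A B) {i : ℕ} (hi : 1 ≤ i) (him : i < A + B) :
    (¬ c.Active s (rule s) i ∧ c.update s (rule s) i = c) ∨
    (c.Active s (rule s) i ∧ c.letter i = Letter.a ∧ c.letter (i + 1) = Letter.b ∧
      (∃ k, c.profile ta tb i + (ta + tb) ≤ c.profile ta tb k) ∧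
      ∀ k, (c.update s (rule s) i).profile ta tb k =
        if k = i then c.profile ta tb i + (ta + tb) else c.profile ta tb k) ∨
    (c.Active s (rule s) i ∧ c.letter i = Letter.b ∧ c.letter (i + 1) = Letter.a ∧
      (∃ k, c.profile ta tb k ≤ c.profile ta tb i - (ta + tb)) ∧
      ∀ k, (c.update s (rule s) i).profile ta tb k =
        if k = i then c.profile ta tb i - (ta + tb) else c.profile ta tb k) := by
  by_cases hact : c.Active s (rule s) i
  swap
  · exact Or.inl ⟨hact, by rw [update, if_neg hact]⟩
  right
  have hupd : c.update s (rule s) i = c.flip i := by rw [update, if_pos hact]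
  have hpred := c.profile_pred ta tb hi him.le
  have hself := c.profile_flip_self ta tb hi him
  have hne := fun k => c.profile_flip_of_ne ta tb (i := i) (k := k) hi
  have hd := fun k => c.dvd_profile_add_sub ta tb (k := k)
  have e : (A + B : ℤ) - (A + B - i) = i := by ring
  have hdr : ∀ k : ℤ, 0 ≤ k → k + (ta + tb) ≤ A + B →
      (ta + tb : ℤ) ∣ c.profile ta tb (A + B - (k + (ta + tb))) - c.profile ta tb (A + B - k) := by
    intro k hk hk'
    have := hd (A + B - (k + (ta + tb))) (by omega) (by omega)
    have e : (A + B : ℤ) - (k + (ta + tb)) + (ta + tb) = A + B - k := by ring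
    rw [e] at this
    exact (dvd_sub_comm).1 this
  rw [hupd]
  rcases hact.reason hta htb hcop (by omega) hi him with ⟨h1, h2, h3⟩ | ⟨h1, h2, h3⟩
  · refine Or.inl ⟨hact, h1, h2, ?_, fun k => ?_⟩
    · rcases h3 with h3 | h3
      · exact h3.exists_le (by omega) (by omega) (by omega) hd
      · obtain ⟨k, hk⟩ := h3.exists_le (by omega) (by omega) (by omega) hdr
        simp only [e] at hk
        exact ⟨_, hk⟩
    · split_ifs with hk
      · rw [hk, hself, hpred]
        simp [h1, h2]
        ring
      · exact hne k hk
  · refine Or.inr ⟨hact, h1, h2, ?_, fun k => ?_⟩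
    · rcases h3 with h3 | h3
      · obtain ⟨k, hk⟩ := h3.exists_le (by omega) (by omega) (by omega) fun k hk hk' => by
          rw [neg_sub_neg]; exact (dvd_sub_comm).1 (hd k hk hk')
        exact ⟨k, by linarith⟩
      · obtain ⟨k, hk⟩ := h3.exists_le (by omega) (by omega) (by omega) fun k hk hk' => by
          rw [neg_sub_neg]; exact (dvd_sub_comm).1 (hdr k hk hk')
        simp only [e] at hk
        exact ⟨_, by linarith⟩
    · split_ifs with hk
      · rw [hk, hself, hpred]
        simp [h1, h2]
        ring
      · exact hne k hk

theorem update_eq_self_of_not_mem (s : ℕ) (δ : LocalRule) (c : Config A B) {i : ℕ}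
    (h : ¬ (1 ≤ i ∧ i < A + B)) : c.update s δ i = c := by
  unfold update flip
  split_ifs <;> rfl

theorem profile_update_le {ta tb : ℕ} (hta : 0 < ta) (htb : 0 < tb) (hcop : Nat.Coprime ta tb)
    {s : ℕ} (hs : ta + tb ≤ s) {c : Config A B} {M : ℤ} (h : ∀ k, c.profile ta tb k ≤ M)
    (i : ℕ) (k : ℤ) : (c.update s (rule s) i).profile ta tb k ≤ M := by
  by_cases hi : 1 ≤ i ∧ i < A + B
  swap
  · rw [update_eq_self_of_not_mem s _ c hi]; exact h k
  rcases c.update_cases hta htb hcop hs hi.1 hi.2 with ⟨-, h1⟩ | ⟨-, -, -, ⟨j, hj⟩, h1⟩ |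
    ⟨-, -, -, -, h1⟩
  · rw [h1]; exact h k
  · rw [h1]
    have := h j
    have := h k
    split_ifs <;> linarith
  · rw [h1]
    have := h i
    have := h k
    split_ifs <;> linarith

theorem le_profile_update {ta tb : ℕ} (hta : 0 < ta) (htb : 0 < tb) (hcop : Nat.Coprime ta tb)
    {s : ℕ} (hs : ta + tb ≤ s) {c : Config A B} {L : ℤ} (h : ∀ k, L ≤ c.profile ta tb k)
    (i : ℕ) (k : ℤ) : L ≤ (c.update s (rule s) i).profile ta tb k := by
  by_cases hi : 1 ≤ i ∧ i < A + B
  swap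
  · rw [update_eq_self_of_not_mem s _ c hi]; exact h k
  rcases c.update_cases hta htb hcop hs hi.1 hi.2 with ⟨-, h1⟩ | ⟨-, -, -, -, h1⟩ |
    ⟨-, -, -, ⟨j, hj⟩, h1⟩
  · rw [h1]; exact h k
  · rw [h1]
    have := h i
    have := h k
    split_ifs <;> linarith
  · rw [h1]
    have := h j
    have := h k
    split_ifs <;> linarith

theorem isNonneg_iff {ta tb : ℕ} (hAB : tb * A = ta * B) {c : Config A B} :
    c.IsNonneg ta tb ↔ ∀ k, 0 ≤ c.profile ta tb k := by
  constructor
  · intro h k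
    rcases le_or_gt k 0 with h0 | h0
    · rw [c.profile_of_le_zero ta tb h0]
    · rcases le_or_gt k (A + B) with h1 | h1
      · exact h k.toNat (by omega)
      · rw [c.profile_of_ge hAB h1.le]
  · exact fun h i _ => h i

theorem profile_eq_min (ta tb : ℕ) (c : Config A B) (k : ℤ) :
    c.profile ta tb k = height ta tb (c.site (min k.toNat (A + B))) := by
  rw [profile]
  rcases le_total k.toNat (A + B) with h | h
  · rw [min_eq_left h]
  · rw [min_eq_right h, c.site_of_ge _ h, c.site_of_ge _ le_rfl]

theorem profile_le_hMax (ta tb : ℕ) (c : Config A B) (k : ℤ) :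
    c.profile ta tb k ≤ c.hMax ta tb := by
  rw [profile_eq_min]
  exact Finset.le_sup' (fun i => height ta tb (c.site i)) (by simp)

theorem hMin_le_profile (ta tb : ℕ) (c : Config A B) (k : ℤ) :
    c.hMin ta tb ≤ c.profile ta tb k := by
  rw [profile_eq_min]
  exact Finset.inf'_le (fun i => height ta tb (c.site i)) (by simp)

theorem exists_profile_eq_hMax (ta tb : ℕ) (c : Config A B) :
    ∃ k, c.profile ta tb k = c.hMax ta tb := by
  obtain ⟨i, -, hi⟩ := Finset.exists_mem_eq_sup' (s := Finset.range (A + B + 1)) ⟨0, by simp⟩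
    (fun i => height ta tb (c.site i))
  exact ⟨i, hi.symm⟩

/-- A flip requires two heights at least `ta + tb` apart, more than the thickness allows. -/
theorem IsChristoffel.isStable {ta tb : ℕ} (hta : 0 < ta) (htb : 0 < tb)
    (hcop : Nat.Coprime ta tb) {s : ℕ} (hs : ta + tb ≤ s) {c : Config A B}
    (h : c.IsChristoffel ta tb) : c.IsStable s (rule s) := by
  intro i hi him hact
  have hle := c.profile_le_hMax ta tb
  have hge := c.hMin_le_profile ta tb
  unfold IsChristoffel at h
  rcases c.update_cases hta htb hcop hs hi (by omega) with ⟨h1, -⟩ | ⟨-, -, -, ⟨j, hj⟩, -⟩ |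
    ⟨-, -, -, ⟨j, hj⟩, -⟩
  · exact h1 hact
  · have := hle j
    have := hge i
    linarith
  · have := hge j
    have := hle i
    linarith

/-! ### Drift of the potential -/

/-- The sites of height `M`. -/
noncomputable def levelSet (ta tb : ℕ) (c : Config A B) (M : ℤ) : Finset ℤ :=
  (Finset.Icc (0 : ℤ) (A + B)).filter fun k => c.profile ta tb k = M

theorem mem_levelSet {ta tb : ℕ} (hAB : tb * A = ta * B) {c : Config A B} {M : ℤ} (hM : 0 < M)
    {k : ℤ} : k ∈ c.levelSet ta tb M ↔ c.profile ta tb k = M := by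
  rw [levelSet, Finset.mem_filter, Finset.mem_Icc, and_iff_right_iff_imp]
  intro h
  constructor
  · by_contra hc
    have := c.profile_of_le_zero ta tb (k := k) (by omega)
    omega
  · by_contra hc
    have := c.profile_of_ge hAB (k := k) (by omega)
    omega

theorem spread_levelSet_le (ta tb : ℕ) (c : Config A B) (M : ℤ) :
    spread (c.levelSet ta tb M) (ta + tb) ≤ A + B + (ta + tb) + 1 := by
  classical
  have h : c.levelSet ta tb M ∪ (c.levelSet ta tb M).image (· + (ta + tb : ℤ)) ⊆
      Finset.Icc (0 : ℤ) (A + B + (ta + tb)) := by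
    intro x hx
    simp only [Finset.mem_union, Finset.mem_image, levelSet, Finset.mem_filter,
      Finset.mem_Icc] at hx ⊢
    rcases hx with h | ⟨y, h, rfl⟩ <;> omega
  have h2 := Finset.card_le_card h
  rw [Int.card_Icc] at h2
  unfold spread
  convert h2.trans (show _ ≤ A + B + (ta + tb) + 1 by omega)

theorem levelData {ta tb : ℕ} (hta : 0 < ta) (htb : 0 < tb) (hcop : Nat.Coprime ta tb)
    (hAB : tb * A = ta * B) (hdvd : ta + tb ∣ A + B) {s : ℕ} (hs : ta + tb ≤ s)
    (hsight : 2 * s ≤ A + B + 1) {c : Config A B} {M : ℤ}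
    (hM : ∀ k, c.profile ta tb k ≤ M) (hpM : (ta + tb : ℤ) ≤ M) :
    LevelData (ta + tb) s (A + B) M (c.profile ta tb)
      (fun k => c.Active s (rule s) k.toNat ∧ c.letter k.toNat = Letter.a)
      (fun k => c.Active s (rule s) k.toNat) where
  p_pos := by omega
  p_le_s := by exact_mod_cast hs
  sight := by exact_mod_cast hsight
  p_le_M := hpM
  p_dvd_m := by exact_mod_cast hdvd
  left i hi := c.profile_of_le_zero ta tb hi
  right i hi := c.profile_of_ge hAB hi
  le := hM
  dvd_step i hi hi' := c.dvd_profile_add_sub ta tb hi hi'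
  dvd_index i hi hi' h := c.dvd_of_dvd_profile hcop hi hi' h
  up_reason i hi hi' hu _ := by
    lift i to ℕ using by omega
    simp only [Int.toNat_natCast] at hu
    rcases hu.1.reason hta htb hcop (by omega) (by omega) (by omega) with ⟨-, -, h⟩ | ⟨h, -⟩
    · exact h
    · rw [hu.2] at h
      exact absurd h (by simp)
  dn_of_low i j hi hi' hiM hj hj' h := by
    lift i to ℕ using by omega
    rw [← hiM] at h
    simp only [Int.toNat_natCast]
    exact active_of_highest hta htb hcop (by omega) (by omega) (by omega)
      (fun k => by rw [hiM]; exact hM k) hj hj' (by exact_mod_cast h)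

/-- The change of `spread` at the highest level in one step. -/
theorem spread_update {ta tb : ℕ} (hta : 0 < ta) (htb : 0 < tb) (hcop : Nat.Coprime ta tb)
    (hAB : tb * A = ta * B) {s : ℕ} (hs : ta + tb ≤ s) {c : Config A B} {M : ℤ}
    (hM : ∀ k, c.profile ta tb k ≤ M) (hpM : (ta + tb : ℤ) ≤ M) {i : ℕ} (hi : 1 ≤ i)
    (him : i < A + B) [Decidable (c.Active s (rule s) i)]
    [Decidable (c.Active s (rule s) i ∧ c.letter i = Letter.a ∧
      c.profile ta tb i = M - (ta + tb))] :
    (spread ((c.update s (rule s) i).levelSet ta tb M) (ta + tb) : ℤ) =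
      spread (c.levelSet ta tb M) (ta + tb) +
        (if (i : ℤ) ∈ c.levelSet ta tb M then
          (if c.Active s (rule s) i then -(vacancies (c.levelSet ta tb M) (ta + tb) i : ℤ) else 0)
        else (if c.Active s (rule s) i ∧ c.letter i = Letter.a ∧
          c.profile ta tb i = M - (ta + tb) then
            (vacancies (c.levelSet ta tb M) (ta + tb) i : ℤ) else 0)) := by
  have hp : (ta + tb : ℤ) ≠ 0 := by omega
  have hM0 : 0 < M := by omega
  have mem : ∀ {c : Config A B} {k : ℤ}, k ∈ c.levelSet ta tb M ↔ c.profile ta tb k = M :=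
    mem_levelSet hAB hM0
  rcases c.update_cases hta htb hcop hs hi him with ⟨h1, h2⟩ | ⟨h1, h2, h3, -, h4⟩ |
    ⟨h1, h2, h3, -, h4⟩
  · rw [h2]
    simp [h1]
  -- The letter after a raised site is `b`, so the next site is higher.
  · have hiS : (i : ℤ) ∉ c.levelSet ta tb M := by
      rw [mem]
      have e1 := c.profile_succ ta tb him
      rw [h3] at e1
      simp at e1
      have e2 := hM (i + 1)
      omega
    rw [if_neg hiS]
    by_cases hl : c.profile ta tb i = M - (ta + tb)
    · rw [if_pos ⟨h1, h2, hl⟩]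
      have e : (c.update s (rule s) i).levelSet ta tb M = insert (i : ℤ) (c.levelSet ta tb M) := by
        ext k
        rw [Finset.mem_insert, mem, mem, h4 k]
        by_cases hk : k = i
        · simp [hk, hl]
        · simp [hk]
      rw [e, spread_insert hp hiS]
      push_cast
      rfl
    · rw [if_neg (fun h => hl h.2.2), add_zero]
      congr 2
      ext k
      rw [mem, mem, h4 k]
      by_cases hk : k = i
      · rw [mem] at hiS
        subst hk
        simp only [if_true, hiS, iff_false]
        omega
      · simp [hk]
  · by_cases hiS : (i : ℤ) ∈ c.levelSet ta tb M
    · rw [if_pos hiS, if_pos h1]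
      have e : (c.update s (rule s) i).levelSet ta tb M = (c.levelSet ta tb M).erase i := by
        ext k
        rw [Finset.mem_erase, mem, mem, h4 k]
        by_cases hk : k = i
        · have := hM i
          subst hk
          simp only [if_true, ne_eq, not_true, false_and, iff_false]
          omega
        · simp [hk]
      have := spread_erase hp hiS
      rw [e, ← this]
      push_cast
      ring
    · rw [if_neg hiS, if_neg (by simp [h2]), add_zero]
      congr 2
      ext k
      rw [mem, mem, h4 k]
      by_cases hk : k = i
      · rw [mem] at hiS
        have := hM i
        subst hk
        simp only [if_true, hiS, iff_false]
        omega
      · simp [hk]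

/-- The potential decreases in mean along the process: its main term is the highest level, its
lower order term is a concave function of the `spread` of the highest level. -/
noncomputable def potential (ta tb : ℕ) (c : Config A B) : ℤ :=
  if c.hMax ta tb < ta + tb then 0 else
    (c.hMax ta tb - (ta + tb)) *
      ((A + B + (ta + tb) + 1) * (2 * (A + B + (ta + tb) + 1) + 1)) +
    spread (c.levelSet ta tb (c.hMax ta tb)) (ta + tb) *
      (2 * (A + B + (ta + tb) + 1) + 1 -
        spread (c.levelSet ta tb (c.hMax ta tb)) (ta + tb))

theorem concave_bounds {x K : ℤ} (hx : 0 ≤ x) (hxK : x ≤ K) :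
    0 ≤ x * (2 * K + 1 - x) ∧ x * (2 * K + 1 - x) ≤ K * (2 * K + 1) := by
  constructor
  · exact mul_nonneg hx (by omega)
  · exact mul_le_mul hxK (by omega) (by omega) (by omega)

theorem potential_nonneg (ta tb : ℕ) (c : Config A B) : 0 ≤ c.potential ta tb := by
  have h := concave_bounds (x := spread (c.levelSet ta tb (c.hMax ta tb)) (ta + tb))
    (K := A + B + (ta + tb) + 1) (by omega) (by exact_mod_cast c.spread_levelSet_le ta tb _)
  unfold potential
  split_ifs with h1
  · exact le_rfl
  · exact add_nonneg (mul_nonneg (by omega) (by positivity)) h.1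

/-- After a step the maximum may have dropped below the old `M`. The formula with the old `M`
remains an upper bound, because losing one level pays for the largest possible value of the concave
term. -/
theorem potential_le {ta tb : ℕ} {c : Config A B} {M : ℤ}
    (hM : ∀ k, c.profile ta tb k ≤ M) (hpM : (ta + tb : ℤ) ≤ M) :
    c.potential ta tb ≤
      (M - (ta + tb)) * ((A + B + (ta + tb) + 1) * (2 * (A + B + (ta + tb) + 1) + 1)) +
      spread (c.levelSet ta tb M) (ta + tb) *
        (2 * (A + B + (ta + tb) + 1) + 1 - spread (c.levelSet ta tb M) (ta + tb)) := by
  have b := fun N => concave_bounds (x := spread (c.levelSet ta tb N) (ta + tb))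
    (K := A + B + (ta + tb) + 1) (by omega) (by exact_mod_cast c.spread_levelSet_le ta tb N)
  obtain ⟨k, hk⟩ := c.exists_profile_eq_hMax ta tb
  have hle : c.hMax ta tb ≤ M := hk ▸ hM k
  have hG : (0 : ℤ) ≤ (A + B + (ta + tb) + 1) * (2 * (A + B + (ta + tb) + 1) + 1) := by positivity
  unfold potential
  split_ifs with h1
  · exact add_nonneg (mul_nonneg (by omega) hG) (b M).1
  · rcases hle.eq_or_lt with he | hlt
    · rw [he]
    · have h2 := (b (c.hMax ta tb)).2
      have h3 := (b M).1
      have h4 : (c.hMax ta tb - (ta + tb) + 1) *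
          ((A + B + (ta + tb) + 1) * (2 * (A + B + (ta + tb) + 1) + 1)) ≤
          (M - (ta + tb)) * ((A + B + (ta + tb) + 1) * (2 * (A + B + (ta + tb) + 1) + 1) : ℤ) :=
        mul_le_mul_of_nonneg_right (by omega) hG
      linarith

theorem sum_potential_update_lt {ta tb : ℕ} (hta : 0 < ta) (htb : 0 < tb)
    (hcop : Nat.Coprime ta tb) (hAB : tb * A = ta * B) (hdvd : ta + tb ∣ A + B) {s : ℕ}
    (hs : ta + tb ≤ s) (hsight : 2 * s ≤ A + B + 1) {c : Config A B}
    (hpM : (ta + tb : ℤ) ≤ c.hMax ta tb) :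
    ∑ i ∈ Finset.Icc 1 (A + B - 1), (c.update s (rule s) i).potential ta tb + 1 ≤
      (A + B - 1 : ℕ) * c.potential ta tb := by
  classical
  have hM := c.profile_le_hMax ta tb
  have hld := levelData hta htb hcop hAB hdvd hs hsight hM hpM
  have hM0 : 0 < c.hMax ta tb := by omega
  have mem : ∀ k : ℤ, k ∈ c.levelSet ta tb (c.hMax ta tb) ↔
    c.profile ta tb k = c.hMax ta tb := fun k => mem_levelSet hAB hM0
  have hV : c.potential ta tb = (c.hMax ta tb - (ta + tb)) *
        ((A + B + (ta + tb) + 1) * (2 * (A + B + (ta + tb) + 1) + 1)) +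
      spread (c.levelSet ta tb (c.hMax ta tb)) (ta + tb) *
        (2 * (A + B + (ta + tb) + 1) + 1 -
          spread (c.levelSet ta tb (c.hMax ta tb)) (ta + tb)) := by
    rw [potential, if_neg (by omega)]
  have hψ : (spread (c.levelSet ta tb (c.hMax ta tb)) (ta + tb) : ℤ) ≤ A + B + (ta + tb) + 1 := by
    exact_mod_cast c.spread_levelSet_le ta tb _
  have hstep := fun i hi him => spread_update hta htb hcop hAB hs hM hpM (i := i) hi him
  have hV' := fun i => potential_le (profile_update_le hta htb hcop hs hM i) hpM
  obtain ⟨k₀, hk₀⟩ := c.exists_profile_eq_hMax ta tb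
  generalize c.hMax ta tb = M at *
  set S := c.levelSet ta tb M with hS
  have hp : (ta + tb : ℤ) ≠ 0 := by omega
  set U : ℤ → Prop := fun k => 1 ≤ k ∧ k < A + B ∧
    (c.Active s (rule s) k.toNat ∧ c.letter k.toNat = Letter.a) ∧
      c.profile ta tb k = M - (ta + tb) with hU
  set D : ℤ → Prop := fun k => c.Active s (rule s) k.toNat with hD
  have hST : S ⊆ Finset.Icc 1 (A + B - 1 : ℤ) := by
    intro k hk
    have := hld.pos_of_highest ((mem k).1 hk)
    rw [Finset.mem_Icc]
    omega
  have hends := hld.inactive_end_of_levelSet mem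
  have hdrift := sum_vacancies_le (U := U) (D := D) hp hST
    (fun k hk => by
      rw [mem, mem]
      exact hld.raised_adjacent hk.1 hk.2.1 hk.2.2.1 hk.2.2.2) hends
  obtain ⟨k₁, hk₁, hDk₁, hvk₁⟩ := exists_active_end (D := D) hp ⟨k₀, (mem _).2 hk₀⟩
    (fun k hk hk' hDk l h1 h2 => (hends _ (Or.inl rfl) k hk hk' hDk l h1 h2).1)
  set x : ℤ → ℤ := fun k => if k ∈ S then (if D k then -(vacancies S (ta + tb) k : ℤ) else 0)
    else (if U k then (vacancies S (ta + tb) k : ℤ) else 0) with hx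
  have hdrift' : ∑ k ∈ Finset.Icc 1 (A + B - 1 : ℤ), x k ≤ 0 := by
    refine le_trans (le_of_eq (Finset.sum_congr rfl fun k _ => ?_)) hdrift
    simp only [hx]
    split_ifs <;> rfl
  have hxi : ∀ i ∈ Finset.Icc 1 (A + B - 1),
      (spread ((c.update s (rule s) i).levelSet ta tb M) (ta + tb) : ℤ) =
        spread S (ta + tb) + x i := by
    intro i hi
    rw [Finset.mem_Icc] at hi
    rw [hstep i hi.1 (by omega), hx]
    have hUi : U i ↔ c.Active s (rule s) i ∧ c.letter i = Letter.a ∧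
        c.profile ta tb i = M - (ta + tb) := by
      simp only [hU, Int.toNat_natCast]
      constructor
      · tauto
      · intro h
        exact ⟨by omega, by omega, ⟨h.1, h.2.1⟩, h.2.2⟩
    simp only [hUi, hD, Int.toNat_natCast]
  have hcast : ∀ f : ℤ → ℤ, ∑ i ∈ Finset.Icc 1 (A + B - 1), f (i : ℕ) =
      ∑ k ∈ Finset.Icc 1 (A + B - 1 : ℤ), f k := by
    intro f
    refine Finset.sum_nbij' (fun i => (i : ℤ)) Int.toNat ?_ ?_ ?_ ?_ ?_
    · intro i hi; rw [Finset.mem_Icc] at hi ⊢; omega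
    · intro i hi; rw [Finset.mem_Icc] at hi ⊢; omega
    · intro i _; simp
    · intro i hi; rw [Finset.mem_Icc] at hi; omega
    · intro i _; rfl
  -- The active end `k₁` alone contributes at least `1`.
  have hsq : 1 ≤ ∑ k ∈ Finset.Icc 1 (A + B - 1 : ℤ), x k ^ 2 := by
    refine le_trans ?_ (Finset.single_le_sum (fun k _ => sq_nonneg (x k)) (hST hk₁))
    have : x k₁ = -(vacancies S (ta + tb) k₁ : ℤ) := by simp only [hx, if_pos hk₁, if_pos hDk₁]
    rw [this]
    have h1 : (1 : ℤ) ≤ vacancies S (ta + tb) k₁ := by exact_mod_cast hvk₁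
    nlinarith
  set K : ℤ := A + B + (ta + tb) + 1 with hK
  -- With `f y = y * (2 * K + 1 - y)`, one has `f (y + x) = f y + (2 * K + 1 - 2 * y) * x - x ^ 2`.
  -- For `y ≤ K` the linear coefficient is positive, so a nonpositive drift helps and the square
  -- gives the strict decrease.
  have hbound : ∀ i ∈ Finset.Icc 1 (A + B - 1), (c.update s (rule s) i).potential ta tb ≤
      c.potential ta tb + ((2 * K + 1 - 2 * spread S (ta + tb)) * x i - x i ^ 2) := by
    intro i hi
    have h1 := hV' i
    rw [hxi i hi] at h1
    rw [hV]
    linarith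
  have hsum := Finset.sum_le_sum hbound
  rw [Finset.sum_add_distrib, Finset.sum_const, Nat.card_Icc,
    hcast (fun k => (2 * K + 1 - 2 * spread S (ta + tb)) * x k - x k ^ 2),
    Finset.sum_sub_distrib, ← Finset.mul_sum] at hsum
  have h0 : (2 * K + 1 - 2 * spread S (ta + tb)) * ∑ k ∈ Finset.Icc 1 (A + B - 1 : ℤ), x k ≤ 0 :=
    mul_nonpos_of_nonneg_of_nonpos (by omega) hdrift'
  rw [add_tsub_cancel_right, nsmul_eq_mul] at hsum
  linarith

theorem potential_le_mul (ta tb : ℕ) (c : Config A B) :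
    c.potential ta tb ≤ (ta * (A + B) + 1) *
      ((A + B + (ta + tb) + 1) * (2 * (A + B + (ta + tb) + 1) + 1)) := by
  have hG : (0 : ℤ) ≤ (A + B + (ta + tb) + 1) * (2 * (A + B + (ta + tb) + 1) + 1) := by positivity
  have b := concave_bounds (x := spread (c.levelSet ta tb (c.hMax ta tb)) (ta + tb))
    (K := A + B + (ta + tb) + 1) (by omega) (by exact_mod_cast c.spread_levelSet_le ta tb _)
  have hM : c.hMax ta tb ≤ ta * (A + B) := by
    obtain ⟨k, hk⟩ := c.exists_profile_eq_hMax ta tb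
    have h1 := c.site_fst_add_snd (min_le_right k.toNat (A + B))
    rw [← hk, profile_eq_min, height]
    have h2 : ((c.site (min k.toNat (A + B))).2 : ℤ) ≤ A + B := by omega
    have h3 := mul_le_mul_of_nonneg_left h2 (by omega : (0 : ℤ) ≤ ta)
    have h4 : (0 : ℤ) ≤ tb * (c.site (min k.toNat (A + B))).1 := by positivity
    linarith
  unfold potential
  split_ifs with h1
  · positivity
  · have := mul_le_mul_of_nonneg_right
      (show c.hMax ta tb - (ta + tb) + 1 ≤ ta * (A + B) + 1 by omega) hG
    linarith [b.2]

/-! ### The nonnegative Christoffel configuration -/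

theorem height_site (ta tb : ℕ) (c : Config A B) {i : ℕ} (hi : i ≤ A + B) :
    height ta tb (c.site i) = ta * i - (ta + tb) * (c.site i).1 := by
  have h : (((c.site i).1 : ℤ) + (c.site i).2) = i := by exact_mod_cast c.site_fst_add_snd hi
  rw [← h, height]
  ring

/-- A height in `[0, ta + tb)` is the remainder of the division of `ta * i` by `ta + tb`, and the
abscissa is its quotient; uniqueness follows. -/
theorem site_fst_eq_ediv {ta tb : ℕ} {c : Config A B} {i : ℕ} (hi : i ≤ A + B)
    (h0 : 0 ≤ height ta tb (c.site i)) (h1 : height ta tb (c.site i) < ta + tb) :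
    (((c.site i).1 : ℕ) : ℤ) = (ta * i : ℤ) / (ta + tb) := by
  rw [c.height_site ta tb hi] at h0 h1
  have hp : (0 : ℤ) < ta + tb := by linarith
  refine le_antisymm ?_ ?_
  · rw [Int.le_ediv_iff_mul_le hp]
    linarith
  · rw [← Int.lt_add_one_iff, Int.ediv_lt_iff_lt_mul hp]
    linarith

theorem eq_of_height_mem {ta tb : ℕ} {c c' : Config A B}
    (h : ∀ i, i ≤ A + B → 0 ≤ height ta tb (c.site i) ∧ height ta tb (c.site i) < ta + tb)
    (h' : ∀ i, i ≤ A + B → 0 ≤ height ta tb (c'.site i) ∧ height ta tb (c'.site i) < ta + tb) :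
    c = c' := by
  ext1
  funext i
  rcases le_total i (A + B) with hi | hi
  · have e1 := site_fst_eq_ediv hi (h i hi).1 (h i hi).2
    have e2 := site_fst_eq_ediv hi (h' i hi).1 (h' i hi).2
    have e3 := c.site_fst_add_snd hi
    have e4 := c'.site_fst_add_snd hi
    refine Prod.ext ?_ ?_ <;> omega
  · rw [c.site_of_ge i hi, c'.site_of_ge i hi]

/-- The configuration of slope `tb / ta` whose heights are in `[0, ta + tb - 1]`. -/
def christoffel (ta tb n : ℕ) (hp : 0 < ta + tb) : Config (n * ta) (n * tb) where
  site i := (ta * min i (n * ta + n * tb) / (ta + tb),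
    min i (n * ta + n * tb) - ta * min i (n * ta + n * tb) / (ta + tb))
  site_zero := by simp
  site_of_ge i hi := by
    have e : ta * (n * ta + n * tb) / (ta + tb) = n * ta := by
      rw [← mul_add, mul_comm, mul_right_comm, Nat.mul_div_cancel _ hp]
    rw [min_eq_right hi, e, Nat.add_sub_cancel_left]
  step i hi := by
    rw [min_eq_left hi.le, min_eq_left hi]
    have h1 : ta * i / (ta + tb) ≤ ta * (i + 1) / (ta + tb) := Nat.div_le_div_right (by gcongr; omega)
    have h2 : ta * (i + 1) / (ta + tb) ≤ ta * i / (ta + tb) + 1 := by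
      rw [← Nat.add_div_right _ hp]
      exact Nat.div_le_div_right (by rw [mul_add_one]; omega)
    have h3 : ta * i / (ta + tb) ≤ i :=
      Nat.div_le_of_le_mul (by rw [add_mul]; exact Nat.le_add_right _ _)
    rcases h1.eq_or_lt with h | h
    · refine ⟨Letter.b, Prod.ext ?_ ?_⟩ <;> simp [Letter.vec] <;> omega
    · refine ⟨Letter.a, Prod.ext ?_ ?_⟩ <;> simp [Letter.vec] <;> omega

theorem height_christoffel (ta tb n : ℕ) (hp : 0 < ta + tb) {i : ℕ} (hi : i ≤ n * ta + n * tb) :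
    height ta tb ((christoffel ta tb n hp).site i) = (ta * i % (ta + tb) : ℕ) := by
  rw [height_site ta tb _ hi]
  have : ((christoffel ta tb n hp).site i).1 = ta * i / (ta + tb) := by
    simp only [christoffel, min_eq_left hi]
  rw [this]
  have h2 := Nat.mod_add_div (ta * i) (ta + tb)
  have h3 : ((ta * i % (ta + tb) : ℕ) : ℤ) + (ta + tb) * (ta * i / (ta + tb) : ℕ) = ta * i := by
    exact_mod_cast h2
  linarith

theorem hMin_of_isNonneg {ta tb : ℕ} {c : Config A B} (h : c.IsNonneg ta tb) :
    c.hMin ta tb = 0 := by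
  refine le_antisymm ?_ (Finset.le_inf' _ _ fun i hi => h i (by simp at hi; omega))
  have := c.hMin_le_profile ta tb 0
  rwa [c.profile_of_le_zero ta tb le_rfl] at this

theorem height_le_hMax (ta tb : ℕ) (c : Config A B) (i : ℕ) :
    height ta tb (c.site i) ≤ c.hMax ta tb := c.profile_le_hMax ta tb i

theorem isNonneg_christoffel (ta tb n : ℕ) (hp : 0 < ta + tb) :
    (christoffel ta tb n hp).IsNonneg ta tb := by
  intro i hi
  rw [height_christoffel ta tb n hp hi]
  positivity

theorem hMax_christoffel {ta tb n : ℕ} (hta : 0 < ta) (htb : 0 < tb) (hcop : Nat.Coprime ta tb)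
    (hn : 1 ≤ n) (hp : 0 < ta + tb) :
    (christoffel ta tb n hp).hMax ta tb = (ta : ℤ) + tb - 1 := by
  refine le_antisymm (Finset.sup'_le _ _ fun i hi => ?_) ?_
  · rw [height_christoffel ta tb n hp (by simp at hi; omega)]
    have := Nat.mod_lt (ta * i) hp
    omega
  -- With `l` inverse to `ta` modulo `ta + tb`, the remainder `ta + tb - 1` is reached at the
  -- residue of `(ta + tb - 1) * l`.
  · obtain ⟨l, -, hl⟩ := Nat.exists_mul_mod_eq_one_of_coprime
      (show Nat.Coprime ta (ta + tb) by simpa using hcop) (by omega)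
    have hk : ta * ((ta + tb - 1) * l % (ta + tb)) % (ta + tb) = ta + tb - 1 := by
      calc ta * ((ta + tb - 1) * l % (ta + tb)) % (ta + tb)
          = ta * ((ta + tb - 1) * l) % (ta + tb) := Nat.mul_mod_mod _ _ _
        _ = (ta + tb - 1) * (ta * l) % (ta + tb) := by rw [mul_left_comm]
        _ = (ta + tb - 1) * (ta * l % (ta + tb)) % (ta + tb) := (Nat.mul_mod_mod _ _ _).symm
        _ = ta + tb - 1 := by rw [hl, mul_one, Nat.mod_eq_of_lt (by omega)]
    have hlt := Nat.mod_lt ((ta + tb - 1) * l) hp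
    have hle : (ta + tb - 1) * l % (ta + tb) ≤ n * ta + n * tb := by
      rw [← mul_add]
      exact hlt.le.trans (Nat.le_mul_of_pos_left _ hn)
    have := height_le_hMax ta tb (christoffel ta tb n hp) ((ta + tb - 1) * l % (ta + tb))
    rw [height_christoffel ta tb n hp hle, hk] at this
    omega

theorem isChristoffel_christoffel {ta tb n : ℕ} (hta : 0 < ta) (htb : 0 < tb)
    (hcop : Nat.Coprime ta tb) (hn : 1 ≤ n) (hp : 0 < ta + tb) :
    (christoffel ta tb n hp).IsChristoffel ta tb := by
  rw [IsChristoffel, hMax_christoffel hta htb hcop hn hp,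
    hMin_of_isNonneg (isNonneg_christoffel ta tb n hp), sub_zero]

theorem eq_christoffel_of_hMax_lt {ta tb n : ℕ} (hp : 0 < ta + tb) {c : Config (n * ta) (n * tb)}
    (h : c.IsNonneg ta tb) (h' : c.hMax ta tb < ta + tb) : c = christoffel ta tb n hp := by
  refine eq_of_height_mem (ta := ta) (tb := tb)
    (fun i hi => ⟨h i hi, (height_le_hMax ta tb c i).trans_lt h'⟩) fun i hi => ?_
  rw [height_christoffel ta tb n hp hi]
  have := Nat.mod_lt (ta * i) hp
  omega

theorem isChristoffel_iff {ta tb n : ℕ} (hta : 0 < ta) (htb : 0 < tb)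
    (hcop : Nat.Coprime ta tb) (hn : 1 ≤ n) (hp : 0 < ta + tb) {c : Config (n * ta) (n * tb)}
    (h : c.IsNonneg ta tb) : c.IsChristoffel ta tb ↔ c = christoffel ta tb n hp := by
  constructor
  · intro hc
    rw [IsChristoffel, hMin_of_isNonneg h] at hc
    exact eq_christoffel_of_hMax_lt hp h (by omega)
  · rintro rfl
    exact isChristoffel_christoffel hta htb hcop hn hp

/-! ### Expected hitting times -/

section Markov

variable {s : ℕ} {δ : LocalRule}

theorem trajectory_congr {c : Config A B} {I I' : ℕ → ℕ} {t : ℕ} (h : ∀ j < t, I j = I' j) :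
    c.trajectory s δ I t = c.trajectory s δ I' t := by
  induction t with
  | zero => rfl
  | succ t ih =>
    rw [trajectory, trajectory, ih fun j hj => h j (by omega), h t (by omega)]

theorem trajectory_induction {P : Config A B → Prop} (hP : ∀ c i, P c → P (c.update s δ i))
    {c : Config A B} (hc : P c) (I : ℕ → ℕ) (t : ℕ) : P (c.trajectory s δ I t) := by
  induction t with
  | zero => exact hc
  | succ t ih => exact hP _ _ ih

variable {Ω : Type*} [MeasurableSpace Ω] {μ : Measure Ω} [IsProbabilityMeasure μ]
  {I : ℕ → Ω → ℕ} {m : ℕ}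

theorem _root_.FlipProcess.IsUniformSelection.lintegral_map (hI : IsUniformSelection μ m I)
    (hm : 2 ≤ m) (t : ℕ) (f : ℕ → ℝ≥0∞) :
    ((m - 1 : ℕ) : ℝ≥0∞) * ∫⁻ i, f i ∂(μ.map (I t)) = ∑ i ∈ Finset.Icc 1 (m - 1), f i := by
  have hN : ((m - 1 : ℕ) : ℝ≥0∞) ≠ 0 := by
    rw [Nat.cast_ne_zero]; omega
  have hsingle : ∀ i ∈ Finset.Icc 1 (m - 1), μ.map (I t) {i} = ((m - 1 : ℕ) : ℝ≥0∞)⁻¹ := by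
    intro i hi
    rw [Measure.map_apply (hI.measurable t) (measurableSet_singleton i)]
    exact hI.uniform t i hi
  have : IsProbabilityMeasure (μ.map (I t)) :=
    Measure.isProbabilityMeasure_map (hI.measurable t).aemeasurable
  have hmass : μ.map (I t) (Finset.Icc 1 (m - 1) : Finset ℕ) = 1 := by
    rw [← sum_measure_singleton, Finset.sum_congr rfl hsingle, Finset.sum_const, Nat.card_Icc,
      Nat.add_sub_cancel, nsmul_eq_mul, ENNReal.mul_inv_cancel hN (ENNReal.natCast_ne_top _)]
  have hae : ∀ᵐ i ∂(μ.map (I t)), i ∈ ((Finset.Icc 1 (m - 1) : Finset ℕ) : Set ℕ) :=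
    (prob_compl_eq_zero_iff (Finset.measurableSet _)).2 hmass
  rw [← Measure.restrict_eq_self_of_ae_mem hae, lintegral_finset, Finset.sum_congr rfl
    fun i hi => by rw [hsingle i hi], ← Finset.sum_mul, mul_comm, mul_assoc,
    ENNReal.inv_mul_cancel hN (ENNReal.natCast_ne_top _), mul_one]

/-- If `V` decreases in mean by `1 / (m - 1)` at each step from a configuration in `bad`, then the
expected number of visits to `bad` is at most `(m - 1) V`. -/
theorem tsum_measure_bad_le (hI : IsUniformSelection μ m I) (hm : 2 ≤ m)
    {P bad : Config A B → Prop} [DecidablePred bad]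
    (hP : ∀ c i, P c → P (c.update s δ i)) {V : Config A B → ℕ}
    (hV : ∀ c, P c → ∑ i ∈ Finset.Icc 1 (m - 1), V (c.update s δ i) +
      (if bad c then 1 else 0) ≤ (m - 1) * V c) {c : Config A B} (hc : P c) :
    ∫⁻ ω, ∑' t, (if bad (c.trajectory s δ (fun t => I t ω) t) then (1 : ℝ≥0∞) else 0) ∂μ ≤
        ((m - 1) * V c : ℕ) ∧
      Measurable fun ω =>
        ∑' t, (if bad (c.trajectory s δ (fun t => I t ω) t) then (1 : ℝ≥0∞) else 0) := by
  -- The state at time `t` depends only on the first `t` indices, so the default value `0` is never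
  -- read. As a function of a finite tuple of naturals it is automatically measurable.
  let ext (t : ℕ) (g : Finset.range t → ℕ) : ℕ → ℕ :=
    fun j => if h : j ∈ Finset.range t then g ⟨j, h⟩ else 0
  let hist (t : ℕ) (ω : Ω) : Finset.range t → ℕ := fun j => I j ω
  have hhist : ∀ t, Measurable (hist t) := fun t => measurable_pi_lambda _ fun j => hI.measurable j
  have htraj : ∀ t ω, c.trajectory s δ (fun t => I t ω) t =
      c.trajectory s δ (ext t (hist t ω)) t := by
    intro t ω
    refine trajectory_congr fun j hj => ?_
    simp [ext, hist, hj]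
  have hmeas : ∀ (t : ℕ) (f : Config A B → ℝ≥0∞),
      Measurable fun ω => f (c.trajectory s δ (fun t => I t ω) t) := by
    intro t f
    simp only [htraj]
    exact (Measurable.of_discrete (f := fun g => f (c.trajectory s δ (ext t g) t))).comp (hhist t)
  have hstep : ∀ t, ((m - 1 : ℕ) : ℝ≥0∞) *
        ∫⁻ ω, (V (c.trajectory s δ (fun t => I t ω) (t + 1)) : ℝ≥0∞) ∂μ +
      ∫⁻ ω, (if bad (c.trajectory s δ (fun t => I t ω) t) then (1 : ℝ≥0∞) else 0) ∂μ ≤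
      ((m - 1 : ℕ) : ℝ≥0∞) * ∫⁻ ω, (V (c.trajectory s δ (fun t => I t ω) t) : ℝ≥0∞) ∂μ := by
    intro t
    -- Independence of the past and the current index makes their joint law a product, so the mean
    -- decrease can be applied for each fixed past.
    have hindep : IndepFun (hist t) (I t) μ := by
      have h1 := hI.indep.indepFun_finset (Finset.range t) {t} (by simp) hI.measurable
      exact h1.comp measurable_id (measurable_pi_apply (⟨t, by simp⟩ : ({t} : Finset ℕ)))
    have hprod := (indepFun_iff_map_prod_eq_prod_map_map (hhist t).aemeasurable
      (hI.measurable t).aemeasurable).1 hindep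
    have : IsProbabilityMeasure (μ.map (I t)) :=
      Measure.isProbabilityMeasure_map (hI.measurable t).aemeasurable
    have e1 : ∫⁻ ω, (V (c.trajectory s δ (fun t => I t ω) (t + 1)) : ℝ≥0∞) ∂μ =
        ∫⁻ g, ∫⁻ i, (V ((c.trajectory s δ (ext t g) t).update s δ i) : ℝ≥0∞)
          ∂(μ.map (I t)) ∂(μ.map (hist t)) := by
      rw [← lintegral_prod (fun q : (Finset.range t → ℕ) × ℕ =>
          (V ((c.trajectory s δ (ext t q.1) t).update s δ q.2) : ℝ≥0∞))
          Measurable.of_discrete.aemeasurable, ← hprod,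
        lintegral_map Measurable.of_discrete ((hhist t).prodMk (hI.measurable t))]
      refine lintegral_congr fun ω => ?_
      rw [trajectory, htraj]
    have e2 : ∀ f : Config A B → ℝ≥0∞, ∫⁻ ω, f (c.trajectory s δ (fun t => I t ω) t) ∂μ =
        ∫⁻ g, f (c.trajectory s δ (ext t g) t) ∂(μ.map (hist t)) := by
      intro f
      rw [lintegral_map Measurable.of_discrete (hhist t)]
      simp only [htraj]
    rw [e1, e2 fun c => if bad c then 1 else 0, e2 fun c => V c,
      ← lintegral_const_mul _ Measurable.of_discrete,
      ← lintegral_const_mul _ Measurable.of_discrete,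
      ← lintegral_add_left Measurable.of_discrete]
    refine lintegral_mono fun g => ?_
    rw [hI.lintegral_map hm t]
    have := (Nat.cast_le (α := ℝ≥0∞)).2 (hV _ (trajectory_induction hP hc (ext t g) t))
    rw [Nat.cast_add, Nat.cast_mul, Nat.cast_sum, Nat.cast_ite, Nat.cast_one, Nat.cast_zero] at this
    exact this
  refine ⟨?_, Measurable.tsum fun t => hmeas t fun c => if bad c then 1 else 0⟩
  rw [lintegral_tsum fun t => (hmeas t fun c => if bad c then 1 else 0).aemeasurable]
  refine ENNReal.tsum_le_of_sum_range_le fun T => ?_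
  -- Keeping the final mean of `V` on the left makes the induction telescope.
  suffices h : ((m - 1 : ℕ) : ℝ≥0∞) *
        ∫⁻ ω, (V (c.trajectory s δ (fun t => I t ω) T) : ℝ≥0∞) ∂μ +
      ∑ t ∈ Finset.range T,
        ∫⁻ ω, (if bad (c.trajectory s δ (fun t => I t ω) t) then (1 : ℝ≥0∞) else 0) ∂μ ≤
      ((m - 1) * V c : ℕ) from le_trans le_add_self h
  induction T with
  | zero => simp [trajectory]
  | succ T ih =>
    rw [Finset.sum_range_succ, add_comm (∑ t ∈ Finset.range T, _), ← add_assoc]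
    exact le_trans (by gcongr; exact hstep T) ih

end Markov

/-! ### Absorption and the coalescence time -/

theorem IsChristoffel.update_eq {ta tb : ℕ} (hta : 0 < ta) (htb : 0 < tb)
    (hcop : Nat.Coprime ta tb) {s : ℕ} (hs : ta + tb ≤ s) {c : Config A B}
    (h : c.IsChristoffel ta tb) (i : ℕ) : c.update s (rule s) i = c := by
  by_cases hi : 1 ≤ i ∧ i < A + B
  · exact if_neg (h.isStable hta htb hcop hs i hi.1 (by omega))
  · exact update_eq_self_of_not_mem s _ c hi

theorem IsChristoffel.trajectory_eq {ta tb : ℕ} (hta : 0 < ta) (htb : 0 < tb)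
    (hcop : Nat.Coprime ta tb) {s : ℕ} (hs : ta + tb ≤ s) {c : Config A B} {I : ℕ → ℕ} {t₀ : ℕ}
    (h : (c.trajectory s (rule s) I t₀).IsChristoffel ta tb) {t : ℕ} (ht : t₀ ≤ t) :
    c.trajectory s (rule s) I t = c.trajectory s (rule s) I t₀ := by
  induction t, ht using Nat.le_induction with
  | base => rfl
  | succ t _ ih => rw [trajectory, ih, h.update_eq hta htb hcop hs]

theorem IsNonneg.update {ta tb : ℕ} (hta : 0 < ta) (htb : 0 < tb) (hcop : Nat.Coprime ta tb)
    (hAB : tb * A = ta * B) {s : ℕ} (hs : ta + tb ≤ s) {c : Config A B} (h : c.IsNonneg ta tb)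
    (i : ℕ) : (c.update s (rule s) i).IsNonneg ta tb := by
  rw [isNonneg_iff hAB] at h ⊢
  exact le_profile_update hta htb hcop hs h i

open Classical in
-- Every time before the first Christoffel one is counted in the series, whose mean is controlled by
-- the potential.
theorem coalescenceTime_le_tsum (ta tb s : ℕ) (δ : LocalRule) (c : Config A B) (I : ℕ → ℕ) :
    c.coalescenceTime ta tb s δ I ≤
      ∑' t, (if ¬ (c.trajectory s δ I t).IsChristoffel ta tb then (1 : ℝ≥0∞) else 0) := by
  by_cases hex : ∃ t, (c.trajectory s δ I t).IsChristoffel ta tb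
  · refine (iInf₂_le (Nat.find hex) (Nat.find_spec hex)).trans ?_
    refine le_trans ?_ (ENNReal.sum_le_tsum (Finset.range (Nat.find hex)))
    rw [Finset.sum_congr rfl fun t ht => if_pos (Nat.find_min hex (Finset.mem_range.1 ht))]
    simp
  · push Not at hex
    simp [hex]

theorem exists_coalescenceTime_eq {ta tb s : ℕ} {δ : LocalRule} {c : Config A B} {I : ℕ → ℕ}
    (h : c.coalescenceTime ta tb s δ I ≠ ∞) :
    ∃ t₀ : ℕ, c.coalescenceTime ta tb s δ I = t₀ ∧
      (c.trajectory s δ I t₀).IsChristoffel ta tb := by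
  classical
  have hex : ∃ t, (c.trajectory s δ I t).IsChristoffel ta tb := by
    by_contra! hc
    exact h (by simp [coalescenceTime, hc])
  refine ⟨Nat.find hex, le_antisymm (iInf₂_le (Nat.find hex) (Nat.find_spec hex)) ?_, Nat.find_spec hex⟩
  exact le_iInf₂ fun t ht => Nat.cast_le.2 (Nat.find_min' hex ht)

open Classical in
theorem sum_toNat_potential_le {ta tb n : ℕ} (hta : 0 < ta) (htb : 0 < tb)
    (hcop : Nat.Coprime ta tb) (hn : 1 ≤ n) {s : ℕ} (hs : ta + tb ≤ s)
    (hsight : 2 * s ≤ n * ta + n * tb + 1) {c : Config (n * ta) (n * tb)}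
    (h : c.IsNonneg ta tb) :
    ∑ i ∈ Finset.Icc 1 (n * ta + n * tb - 1), ((c.update s (rule s) i).potential ta tb).toNat +
      (if ¬ c.IsChristoffel ta tb then 1 else 0) ≤
        (n * ta + n * tb - 1) * (c.potential ta tb).toNat := by
  by_cases hc : c.IsChristoffel ta tb
  · rw [if_neg (not_not.2 hc), Finset.sum_congr rfl fun i _ => by
      rw [hc.update_eq hta htb hcop hs i]]
    simp
  · rw [if_pos hc]
    have hpM : (ta + tb : ℤ) ≤ c.hMax ta tb := by
      by_contra! hlt
      exact hc ((isChristoffel_iff hta htb hcop hn (by omega) h).2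
        (eq_christoffel_of_hMax_lt (by omega) h hlt))
    have := sum_potential_update_lt hta htb hcop (by ring) ⟨n, by ring⟩ hs hsight hpM
    zify
    simpa only [Int.toNat_of_nonneg (potential_nonneg _ _ _)] using this

end Config

/-- The constant of the bound on the expected coalescence time. -/
def coalescenceConstant (ta tb : ℕ) : ℕ :=
  (ta + tb) * (ta * (ta + tb) + 1) * (2 * (ta + tb) + 1) * (4 * (ta + tb) + 3)

theorem Config.mul_toNat_potential_le {ta tb n : ℕ} (hn : 1 ≤ n) (c : Config (n * ta) (n * tb)) :
    (n * ta + n * tb - 1) * (c.potential ta tb).toNat ≤ coalescenceConstant ta tb * n ^ 4 := by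
  have h1 := c.potential_le_mul ta tb
  have h2 : (c.potential ta tb).toNat ≤ (ta * (n * ta + n * tb) + 1) *
      ((n * ta + n * tb + (ta + tb) + 1) * (2 * (n * ta + n * tb + (ta + tb) + 1) + 1)) := by
    zify
    rw [Int.toNat_of_nonneg (c.potential_nonneg ta tb)]
    exact_mod_cast h1
  have hm : n * ta + n * tb = n * (ta + tb) := by ring
  rw [hm] at h2 ⊢
  unfold coalescenceConstant
  generalize ta + tb = p at *
  have hnp : p ≤ n * p := Nat.le_mul_of_pos_left p hn
  calc (n * p - 1) * (c.potential ta tb).toNat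
      ≤ (n * p) * ((ta * (n * p) + 1) * ((n * p + p + 1) * (2 * (n * p + p + 1) + 1))) := by
        gcongr; omega
    -- Replacing each `1` by `n` and `p` by `n * p` makes every factor a multiple of `n`.
    _ ≤ (n * p) * ((ta * (n * p) + n) * ((n * p + n * p + n) *
          (2 * (n * p + n * p + n) + n))) := by gcongr
    _ = (p * (ta * p + 1) * (2 * p + 1) * (4 * p + 3)) * n ^ 4 := by ring

end FlipProcess

theorem mainTheorem1 (ta tb : ℕ) (hta : 0 < ta) (htb : 0 < tb) (hcop : Nat.Coprime ta tb) :
    ∃ C : ℝ≥0, ∀ s n : ℕ, ta + tb ≤ s → 1 ≤ n →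
      FlipProcess.TotallySymmetric s (FlipProcess.rule s) ∧
      (∀ c : FlipProcess.Config (n * ta) (n * tb),
        c.IsChristoffel ta tb → c.IsStable s (FlipProcess.rule s)) ∧
      ∃ cs : FlipProcess.Config (n * ta) (n * tb),
        cs.IsChristoffel ta tb ∧
        cs.hMin ta tb = 0 ∧ cs.hMax ta tb = (ta : ℤ) + (tb : ℤ) - 1 ∧
        (∀ c : FlipProcess.Config (n * ta) (n * tb),
          c.hMin ta tb = 0 → c.hMax ta tb = (ta : ℤ) + (tb : ℤ) - 1 → c = cs) ∧
        (2 * s ≤ n * ta + n * tb + 1 →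
          ∀ c₀ : FlipProcess.Config (n * ta) (n * tb), c₀.IsNonneg ta tb →
          ∀ (Ω : Type*) [MeasurableSpace Ω] (μ : Measure Ω) [IsProbabilityMeasure μ]
            (I : ℕ → Ω → ℕ), FlipProcess.IsUniformSelection μ (n * ta + n * tb) I →
            (∀ᵐ ω ∂μ, ∃ t₀ : ℕ,
              c₀.coalescenceTime ta tb s (FlipProcess.rule s) (fun t => I t ω) = (t₀ : ℝ≥0∞) ∧
              ∀ t, t₀ ≤ t → c₀.trajectory s (FlipProcess.rule s) (fun t => I t ω) t = cs) ∧
            ∫⁻ ω, c₀.coalescenceTime ta tb s (FlipProcess.rule s) (fun t => I t ω) ∂μ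
              ≤ (C : ℝ≥0∞) * (n : ℝ≥0∞) ^ 4) := by
  classical
  have hp : 0 < ta + tb := by omega
  refine ⟨FlipProcess.coalescenceConstant ta tb, fun s n hs hn =>
    ⟨FlipProcess.totallySymmetric_rule s, fun c hc => hc.isStable hta htb hcop hs,
      FlipProcess.Config.christoffel ta tb n hp,
      FlipProcess.Config.isChristoffel_christoffel hta htb hcop hn hp,
      FlipProcess.Config.hMin_of_isNonneg (FlipProcess.Config.isNonneg_christoffel ta tb n hp),
      FlipProcess.Config.hMax_christoffel hta htb hcop hn hp, fun c h0 h1 => ?_, ?_⟩⟩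
  · refine FlipProcess.Config.eq_christoffel_of_hMax_lt hp (fun i _ => ?_) (by omega)
    exact h0 ▸ c.hMin_le_profile ta tb i
  · intro hsight c₀ hc₀ Ω _ μ _ I hI
    have hAB : tb * (n * ta) = ta * (n * tb) := by ring
    have hm : 2 ≤ n * ta + n * tb := by
      have := Nat.mul_pos hn hta
      have := Nat.mul_pos hn htb
      omega
    have hupd : ∀ (c : FlipProcess.Config (n * ta) (n * tb)) i, c.IsNonneg ta tb →
        (c.update s (FlipProcess.rule s) i).IsNonneg ta tb :=
      fun c i hc => hc.update hta htb hcop hAB hs i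
    obtain ⟨hint, hmeas⟩ := FlipProcess.Config.tsum_measure_bad_le hI hm
      (bad := fun c => ¬ c.IsChristoffel ta tb) (V := fun c => (c.potential ta tb).toNat) hupd
      (fun c hc => FlipProcess.Config.sum_toNat_potential_le hta htb hcop hn hs hsight hc) hc₀
    have hle := fun ω => c₀.coalescenceTime_le_tsum ta tb s (FlipProcess.rule s) (fun t => I t ω)
    constructor
    -- A finite mean number of non-Christoffel times makes that number almost surely finite, hence
    -- also the coalescence time.
    · filter_upwards [ae_lt_top hmeas (ne_top_of_le_ne_top (ENNReal.natCast_ne_top _) hint)]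
        with ω hω
      obtain ⟨t₀, h1, h2⟩ := FlipProcess.Config.exists_coalescenceTime_eq
        (ne_top_of_le_ne_top hω.ne (hle ω))
      refine ⟨t₀, h1, fun t ht => ?_⟩
      rw [h2.trajectory_eq hta htb hcop hs ht]
      exact (FlipProcess.Config.isChristoffel_iff hta htb hcop hn hp
        (FlipProcess.Config.trajectory_induction hupd hc₀ _ t₀)).1 h2
    · refine ((lintegral_mono hle).trans hint).trans ?_
      have := (Nat.cast_le (α := ℝ≥0∞)).2 (c₀.mul_toNat_potential_le hn)
      exact this.trans_eq (by push_cast; rfl)
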